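/- Let $0\le m<n$, let $f:\mathbb R^n\to\mathbb R^n$ and $B:\mathbb R^n\to\mathbb R^{n\times m}$ be smooth with $B(x)$ of full column rank for every $x$ and columns $B_i$, and consider the control system $\dot x=f(x)+B(x)u$. Suppose that there is a smooth symmetric matrix function $M:\mathbb R^n\to\mathbb R^{n\times n}$ with $\underline p I\le M(x)\le\bar p I$ for some $\underline p>0$, and a constant $\lambda>0$, such that for all $x$: (i) for every $v\neq0$, if $v^\top M(x)B(x)=0$ then $v^\top\big[\partial_fM(x)+2M(x)\frac{\partial f}{\partial x}(x)\big]v\le-\lambda\,v^\top M(x)v$; (ii) $\partial_{B_i}M(x)+\frac{\partial B_i}{\partial x}(x)^\top M(x)+M(x)\frac{\partial B_i}{\partial x}(x)=0$ for $i=1,\dots,m$. Here $\partial_gM=\sum_i\frac{\partial M}{\partial x_i}g_i$. Let $r>\frac1{2\lambda}$, $\gamma_0>0$, and let $\gamma:\mathbb R^n\to\mathbb R_{\ge0}$ be smooth with $$\gamma(x)\ \ge\ \frac r{\underline p}\Big\|\partial_fM(x)+\tfrac{\partial f}{\partial x}(x)^\top M(x)+M(x)\tfrac{\partial f}{\partial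 x}(x)\Big\|^2\qquad\text{for all }x$$ (spectral norm). Set $$K(x)=-[\gamma(x)+\gamma_0]\,\big[(M(x)B(x))^\top M(x)B(x)\big]^{-1}(M(x)B(x))^\top\in\mathbb R^{m\times n},$$ let $K_i$ be the $i$-th column of $K$, and $$\beta(x,z)=\sum_{i=1}^n\int_0^{x_i}K_i(z_1,\dots,z_{i-1},\mu,z_{i+1},\dots,z_n)\,d\mu .$$ Let $u_d:[0,\infty)\to\mathbb R^m$ be bounded and $C^1$, let $x_d:[0,\infty)\to\mathbb R^n$ be a bounded solution of $\dot x_d=f(x_d)+B(x_d)u_d(t)$, $x_d(0)=x_{d0}$, and let $\ell>0$. Consider the closed loop $$\dot x=f(x)+B(x)u,\qquad \dot z=f(x)+B(x)u-\ell(z-x),\qquad u=u_d+\beta(x,z)-\beta(x_d,z).$$ Call a system contracting from a set $S$ of initial states if from each of them there is a solution on $[0,\infty)$ and there are $k_1,k_2>0$ such that any two solutions $\xi_1,\xi_2$ on $[0,\infty)$ starting in $S$ satisfy $|\xi_1(t)-\xi_2(t)|\le k_1e^{-k_2t}|\xi_1(0)-\xi_2(0)|$ for all $t\ge0$. Then there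 is $\varepsilon_\star>0$ such that for every $0<\varepsilon<\varepsilon_\star$, with $\mathcal B_\varepsilon(x_{d0})$ the open ball of radius $\varepsilon$ around $x_{d0}$: (a) the closed loop, as a system with state $(x,z)$, is contracting from $\mathcal B_\varepsilon(x_{d0})\times\mathcal B_\varepsilon(x_{d0})$; (b) for every closed-loop solution $(x,z)$ on $[0,\infty)$ with $x(0),z(0)\in\mathcal B_\varepsilon(x_{d0})$, the system $\dot\xi=f(\xi)+B(\xi)\alpha(\xi,t)$ with $\alpha(\xi,t)=u_d(t)+\beta(\xi,z(t))-\beta(x_d(t),z(t))$ is contracting from $\mathcal B_\varepsilon(x_{d0})$, and $\lim_{t\to\infty}|x(t)-x_d(t)|=0$. -/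

import Mathlib

open Set Filter Topology MeasureTheory
open scoped ContDiff InnerProductSpace

noncomputable section

namespace CCM

/-- `ℝⁿ` with the Euclidean norm. Matrices in `ℝ^{p × q}` are written as linear maps
`Vec q →L[ℝ] Vec p`; the transpose is the adjoint and the norm is the spectral norm. -/
abbrev Vec (n : ℕ) := EuclideanSpace ℝ (Fin n)

/-- The `i`-th vector of the standard basis of `ℝⁿ`. -/
def stdBasis {n : ℕ} (i : Fin n) : Vec n := EuclideanSpace.single i (1 : ℝ)

/-- The matrix `∂_f M(x) + 2 sym{(∂f/∂x)ᵀ M(x)} = ∂_f M + (∂f/∂x)ᵀ M + M (∂f/∂x)`. -/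
def driftForm {n : ℕ} (f : Vec n → Vec n) (M : Vec n → (Vec n →L[ℝ] Vec n)) (x : Vec n) :
    Vec n →L[ℝ] Vec n :=
  fderiv ℝ M x (f x) +
    ((ContinuousLinearMap.adjoint (fderiv ℝ f x)) ∘L (M x) + (M x) ∘L (fderiv ℝ f x))

/-- `M` is a (strong) control contraction metric with rate `lam` for `ẋ = f(x) + B(x) u`:
a smooth symmetric matrix function with `plow I ≤ M(x) ≤ pup I`, which contracts the directions
`v` with `vᵀ M(x) B(x) = 0`, and for which every column `B_i` of `B` is a Killing field. -/
structure IsControlContractionMetric {n m : ℕ} (f : Vec n → Vec n)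
    (B : Vec n → (Vec m →L[ℝ] Vec n)) (M : Vec n → (Vec n →L[ℝ] Vec n))
    (plow pup lam : ℝ) : Prop where
  smooth : ContDiff ℝ ∞ M
  symm : ∀ x, IsSelfAdjoint (M x)
  plow_pos : 0 < plow
  lower : ∀ x v, plow * ‖v‖ ^ 2 ≤ ⟪v, M x v⟫_ℝ
  upper : ∀ x v, ⟪v, M x v⟫_ℝ ≤ pup * ‖v‖ ^ 2
  lam_pos : 0 < lam
  contracting : ∀ x v, v ≠ 0 → (∀ w : Vec m, ⟪v, M x (B x w)⟫_ℝ = 0) →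
    ⟪v, (fderiv ℝ M x (f x)) v + (2 : ℝ) • M x (fderiv ℝ f x v)⟫_ℝ ≤ -lam * ⟪v, M x v⟫_ℝ
  killing : ∀ x (i : Fin m),
    fderiv ℝ M x (B x (stdBasis i)) +
      (ContinuousLinearMap.adjoint (fderiv ℝ (fun y => B y (stdBasis i)) x)) ∘L (M x) +
      (M x) ∘L (fderiv ℝ (fun y => B y (stdBasis i)) x) = 0

/-- The damping matrix `R(x) = [(M B)ᵀ (M B)]⁻¹`. -/
def damping {n m : ℕ} (B : Vec n → (Vec m →L[ℝ] Vec n)) (M : Vec n → (Vec n →L[ℝ] Vec n))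
    (x : Vec n) : Vec m →L[ℝ] Vec m :=
  ContinuousLinearMap.inverse
    ((ContinuousLinearMap.adjoint ((M x) ∘L (B x))) ∘L ((M x) ∘L (B x)))

/-- The differential feedback gain `K(x) = -[γ(x) + γ₀] R(x) [M(x) B(x)]ᵀ`. -/
def gain {n m : ℕ} (B : Vec n → (Vec m →L[ℝ] Vec n)) (M : Vec n → (Vec n →L[ℝ] Vec n))
    (γ : Vec n → ℝ) (γ₀ : ℝ) (x : Vec n) : Vec n →L[ℝ] Vec m :=
  (-(γ x + γ₀)) • ((damping B M x) ∘L (ContinuousLinearMap.adjoint ((M x) ∘L (B x))))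

/-- `β(x,z) = ∑ᵢ ∫₀^{xᵢ} Kᵢ(z₁, …, z_{i-1}, μ, z_{i+1}, …, zₙ) dμ`, where `Kᵢ` is the `i`-th
column of `K`. -/
def partialIntegral {n m : ℕ} (K : Vec n → (Vec n →L[ℝ] Vec m)) (x z : Vec n) : Vec m :=
  ∑ i : Fin n, ∫ μ in (0 : ℝ)..(x i),
    K (WithLp.toLp 2 (Function.update (WithLp.ofLp z) i μ)) (stdBasis i)

/-- `x` solves `ẋ = F(t, x)` on `[0, ∞)`. -/
def IsSolution {X : Type*} [NormedAddCommGroup X] [NormedSpace ℝ X]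
    (F : ℝ → X → X) (x : ℝ → X) : Prop :=
  ∀ t : ℝ, 0 ≤ t → HasDerivWithinAt x (F t (x t)) (Ici 0) t

/-- `ẋ = F(t, x)` is contracting (incrementally exponentially stable) for initial conditions
in `S`: solutions that start in `S` at time `0` exist for all `t ≥ 0`, and any two of them satisfy
`|x₁(t) - x₂(t)| ≤ k₁ exp(-k₂ t) |x₁(0) - x₂(0)|`. -/
def IsContractingFrom {X : Type*} [NormedAddCommGroup X] [NormedSpace ℝ X]
    (F : ℝ → X → X) (S : Set X) : Prop :=
  (∀ x₀ ∈ S, ∃ x : ℝ → X, x 0 = x₀ ∧ IsSolution F x) ∧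
  ∃ k₁ k₂ : ℝ, 0 < k₁ ∧ 0 < k₂ ∧
    ∀ x₁ x₂ : ℝ → X, IsSolution F x₁ → IsSolution F x₂ → x₁ 0 ∈ S → x₂ 0 ∈ S →
      ∀ t : ℝ, 0 ≤ t → ‖x₁ t - x₂ t‖ ≤ k₁ * Real.exp (-k₂ * t) * ‖x₁ 0 - x₂ 0‖

/-- The control system `ẋ = f(x) + B(x) u` under a time-varying feedback `u = α(x, t)`. -/
def plant {n m : ℕ} (f : Vec n → Vec n) (B : Vec n → (Vec m →L[ℝ] Vec n))
    (α : Vec n → ℝ → Vec m) (t : ℝ) (x : Vec n) : Vec n :=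
  f x + B x (α x t)

/-- The feedback `u_d(t) + β(x, z) - β(x_d(t), z)`. -/
def feedback {n m : ℕ} (K : Vec n → (Vec n →L[ℝ] Vec m)) (xd : ℝ → Vec n) (ud : ℝ → Vec m)
    (t : ℝ) (x z : Vec n) : Vec m :=
  ud t + partialIntegral K x z - partialIntegral K (xd t) z

/-- The closed loop, with state `(x, z)`:
`ẋ = f(x) + B(x) u`, `ż = f(x) + B(x) u - ℓ (z - x)`, `u = u_d + β(x, z) - β(x_d, z)`. -/
def closedLoop {n m : ℕ} (f : Vec n → Vec n) (B : Vec n → (Vec m →L[ℝ] Vec n))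
    (K : Vec n → (Vec n →L[ℝ] Vec m)) (xd : ℝ → Vec n) (ud : ℝ → Vec m) (l : ℝ)
    (t : ℝ) (p : Vec n × Vec n) : Vec n × Vec n :=
  (f p.1 + B p.1 (feedback K xd ud t p.1 p.2),
    f p.1 + B p.1 (feedback K xd ud t p.1 p.2) - l • (p.2 - p.1))

end CCM

end

namespace CCM

/-! ### Global solutions and incremental Lyapunov functions in a tube -/

section Ode

variable {X : Type*} [NormedAddCommGroup X] [NormedSpace ℝ X]

/-! Everything happens in a thin tube around the target, so it is enough to contract differences of
solutions in the quadratic form of `M (xd t)`; no geodesics of the metric are needed. At `x = z =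
xd`, the `x`-derivative of `β(x,z) - β(xd,z)` is `K` and its `z`-derivative vanishes. The plant
therefore linearizes to `v ↦ f'v + (B'v)u + BKv`, although `β` need not be an antiderivative of `K`.

In the derivative of `⟪v, M v⟫` along this linearization the Killing condition cancels all terms in
`u`. The part `BKv` contributes `-2(γ + γ₀)‖v₁‖²`, with `v₁` the orthogonal projection of `v` onto
the range of `MB`. On the orthogonal complement of that range the drift form is negative definite,
and the lower bound on `γ` is what is needed to absorb the cross terms and the `v₁` block
(`inner_apply_add_le`). This gives decay at some rate `μ > 0` (`inner_linearization_le`).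

Since `xd` and `ud` are bounded, compactness makes the linearization error at most a constant times
`ρ(‖x - y‖ + ‖z - z'‖)` in a tube of radius `ρ`, uniformly in time (`exists_linearization_bound`,
`exists_isTubeBound`). For the closed loop the Lyapunov function is the metric term plus `‖e₂ -
e₁‖²`, because `z - x` decays at rate `ℓ` whatever the input is
(`isIncrementalLyapunov_closedLoop`). Decay keeps solutions in the tube, hence they exist for all
time and contract (`isContractingFrom`). Applied to the closed loop, this keeps `z` near `xd`; the
plant driven by this `z` then contracts in the same metric. Tracking is the comparison with the
solution `(xd, xd)`. -/

theorem IsSolution.continuousOn {F : ℝ → X → X} {x : ℝ → X} (hx : IsSolution F x) :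
    ContinuousOn x (Ici 0) :=
  fun t ht => (hx t ht).continuousWithinAt

theorem IsSolution.hasDerivAt {F : ℝ → X → X} {x : ℝ → X} (hx : IsSolution F x) {t : ℝ}
    (ht : 0 < t) : HasDerivAt x (F t (x t)) t :=
  (hx t ht.le).hasDerivAt (Ici_mem_nhds ht)

/-- The radial retraction of a normed space onto the closed ball of radius `ρ` around `0`. -/
noncomputable def radialRetraction (ρ : ℝ) (v : X) : X := (ρ / max ρ ‖v‖) • v

theorem norm_radialRetraction_le {ρ : ℝ} (hρ : 0 < ρ) (v : X) :
    ‖radialRetraction ρ v‖ ≤ ρ := by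
  have hm : 0 < max ρ ‖v‖ := lt_max_of_lt_left hρ
  rw [radialRetraction, norm_smul, Real.norm_of_nonneg (by positivity), div_mul_eq_mul_div,
    div_le_iff₀ hm]
  exact mul_le_mul_of_nonneg_left (le_max_right _ _) hρ.le

theorem radialRetraction_of_norm_le {ρ : ℝ} (hρ : 0 < ρ) {v : X} (hv : ‖v‖ ≤ ρ) :
    radialRetraction ρ v = v := by
  rw [radialRetraction, max_eq_left hv, div_self hρ.ne', one_smul]

/-- One `‖u - v‖` comes from moving the vector and one from changing the scaling factor. No inner
product is used, since the closed-loop state space carries the sup norm of a product. -/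
theorem norm_radialRetraction_sub_le {ρ : ℝ} (hρ : 0 < ρ) (u v : X) :
    ‖radialRetraction ρ u - radialRetraction ρ v‖ ≤ 2 * ‖u - v‖ := by
  have hu : 0 < max ρ ‖u‖ := lt_max_of_lt_left hρ
  have hv : 0 < max ρ ‖v‖ := lt_max_of_lt_left hρ
  have hmm : |max ρ ‖v‖ - max ρ ‖u‖| ≤ ‖u - v‖ := by
    rw [max_comm ρ, max_comm ρ]
    refine (abs_max_sub_max_le_abs _ _ _).trans ?_
    rw [norm_sub_rev]
    exact abs_norm_sub_norm_le v u
  have hsplit : radialRetraction ρ u - radialRetraction ρ v =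
      (ρ / max ρ ‖u‖) • (u - v) + (ρ / max ρ ‖u‖ - ρ / max ρ ‖v‖) • v := by
    simp only [radialRetraction, smul_sub, sub_smul]
    abel
  have hle : ρ / max ρ ‖u‖ ≤ 1 := (div_le_one hu).2 (le_max_left _ _)
  have h1 : ‖(ρ / max ρ ‖u‖) • (u - v)‖ ≤ ‖u - v‖ := by
    rw [norm_smul, Real.norm_of_nonneg (by positivity)]
    exact mul_le_of_le_one_left (norm_nonneg _) hle
  have h2 : ‖(ρ / max ρ ‖u‖ - ρ / max ρ ‖v‖) • v‖ ≤ ‖u - v‖ := by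
    have heq : ρ / max ρ ‖u‖ - ρ / max ρ ‖v‖ =
        (ρ / max ρ ‖u‖) * ((max ρ ‖v‖ - max ρ ‖u‖) / max ρ ‖v‖) := by
      field_simp
    rw [norm_smul, heq, norm_mul, Real.norm_of_nonneg (div_nonneg hρ.le hu.le), norm_div,
      Real.norm_of_nonneg hv.le, Real.norm_eq_abs, mul_assoc]
    refine (mul_le_of_le_one_left (by positivity) hle).trans ?_
    rw [div_mul_eq_mul_div, div_le_iff₀ hv]
    exact mul_le_mul hmm (le_max_right _ _) (norm_nonneg _) (norm_nonneg _)
  rw [hsplit]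
  linarith [norm_add_le ((ρ / max ρ ‖u‖) • (u - v)) ((ρ / max ρ ‖u‖ - ρ / max ρ ‖v‖) • v)]

/-- A bounded, globally Lipschitz, time-dependent vector field has solutions on `[0, ∞)`. -/
theorem exists_isSolution_of_bounded_lipschitz [CompleteSpace X] {F : ℝ → X → X}
    {C L : NNReal} (hC : ∀ t x, ‖F t x‖ ≤ C) (hL : ∀ t, LipschitzWith L (F t))
    (hF : ∀ x, Continuous fun t => F t x) (x₀ : X) :
    ∃ x : ℝ → X, x 0 = x₀ ∧ IsSolution F x := by
  have hloc : ∀ N : ℕ, ∃ x : ℝ → X, x 0 = x₀ ∧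
      ∀ t ∈ Icc (0 : ℝ) N, HasDerivWithinAt x (F t (x t)) (Icc 0 N) t := by
    intro N
    -- With speed at most `C`, a ball of radius `C * N` cannot be left before time `N`.
    have hpl : IsPicardLindelof F (⟨0, le_rfl, N.cast_nonneg⟩ : Icc (0 : ℝ) N) x₀ (C * N) 0 C L :=
      { lipschitzOnWith := fun t _ => (hL t).lipschitzOnWith
        continuousOn := fun x _ => (hF x).continuousOn
        norm_le := fun t _ x _ => hC t x
        mul_max_le := by simp }
    exact hpl.exists_eq_forall_mem_Icc_hasDerivWithinAt₀
  choose φ hφ0 hφ using hloc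
  have huniq : ∀ N N' : ℕ, N ≤ N' → EqOn (φ N) (φ N') (Icc 0 N) := by
    intro N N' hN
    have hN' : (N : ℝ) ≤ N' := by exact_mod_cast hN
    have key : ∀ n' : ℕ, (N : ℝ) ≤ n' → ∀ t ∈ Ico (0 : ℝ) N,
        HasDerivWithinAt (φ n') (F t (φ n' t)) (Ici t) t := by
      intro n' hn' t ht
      refine (hφ n' t ⟨ht.1, (ht.2.trans_le hn').le⟩).mono_of_mem_nhdsWithin ?_
      exact mem_of_superset (Icc_mem_nhdsGE (ht.2.trans_le hn')) (Icc_subset_Icc_left ht.1)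
    refine ODE_solution_unique hL (fun t ht => (hφ N t ht).continuousWithinAt) (key N le_rfl)
      (fun t ht => ((hφ N' t ⟨ht.1, ht.2.trans hN'⟩).continuousWithinAt).mono
        (Icc_subset_Icc_right hN')) (key N' hN') ?_
    rw [hφ0, hφ0]
  refine ⟨fun t => φ (⌊t⌋₊ + 1) t, by simp [hφ0], fun t ht => ?_⟩
  -- An integer above `t`: near `t` the glued function is then the single local solution `φ N`.
  set N := ⌊t⌋₊ + 2 with hNdef
  have heq : ∀ s ∈ Ico (0 : ℝ) N, φ (⌊s⌋₊ + 1) s = φ N s := by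
    intro s hs
    have h1 : ⌊s⌋₊ < N := (Nat.floor_lt hs.1).2 hs.2
    exact huniq _ _ h1 ⟨hs.1, by push_cast; exact (Nat.lt_floor_add_one s).le⟩
  have htN : t < N := by
    rw [hNdef]; push_cast; linarith [Nat.lt_floor_add_one t]
  have hd := hφ N t ⟨ht, htN.le⟩
  have hmem : Ico (0 : ℝ) N ∈ 𝓝[Ici 0] t :=
    mem_nhdsWithin.2 ⟨Iio (N : ℝ), isOpen_Iio, htN, fun s hs => ⟨hs.2, hs.1⟩⟩
  have hd' : HasDerivWithinAt (φ N) (F t (φ N t)) (Ici 0) t :=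
    hd.mono_of_mem_nhdsWithin (mem_of_superset hmem Ico_subset_Icc_self)
  have hval := heq t ⟨ht, htN⟩
  simp only [hval]
  exact hd'.congr_of_eventuallyEq (mem_of_superset hmem heq) hval

/-- `W` is a quadratically bounded Lyapunov function for the difference of two solutions of
`ẋ = F(t, x)` in the tube of radius `ρ` around the curve `y`, with decay rate `2 κ`. -/
structure IsIncrementalLyapunov (F : ℝ → X → X) (y : ℝ → X) (ρ c₁ c₂ κ : ℝ)
    (W : ℝ → X → ℝ) : Prop where
  lower : ∀ t, 0 ≤ t → ∀ e, c₁ * ‖e‖ ^ 2 ≤ W t e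
  upper : ∀ t, 0 ≤ t → ∀ e, W t e ≤ c₂ * ‖e‖ ^ 2
  continuousOn : ContinuousOn (Function.uncurry W) (Ici 0 ×ˢ univ)
  decay : ∀ t, 0 < t → ∀ x₁ x₂ : ℝ → X, x₁ t ∈ Metric.ball (y t) ρ → x₂ t ∈ Metric.ball (y t) ρ →
    HasDerivAt x₁ (F t (x₁ t)) t → HasDerivAt x₂ (F t (x₂ t)) t →
    ∃ w, HasDerivAt (fun s => W s (x₁ s - x₂ s)) w t ∧ w ≤ -(2 * κ) * W t (x₁ t - x₂ t)

namespace IsIncrementalLyapunov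

variable {F : ℝ → X → X} {y : ℝ → X} {ρ c₁ c₂ κ : ℝ} {W : ℝ → X → ℝ}

/-- Grönwall: `exp (2κt) W` is nonincreasing along the difference. Interior derivatives suffice, so
the solutions may touch the boundary of the tube at time `T`. -/
theorem apply_le_exp_mul (h : IsIncrementalLyapunov F y ρ c₁ c₂ κ W) {x₁ x₂ : ℝ → X} {T : ℝ}
    (hT : 0 ≤ T) (h₁ : ContinuousOn x₁ (Icc 0 T)) (h₂ : ContinuousOn x₂ (Icc 0 T))
    (h₁' : ∀ t ∈ Ioo 0 T, x₁ t ∈ Metric.ball (y t) ρ ∧ HasDerivAt x₁ (F t (x₁ t)) t)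
    (h₂' : ∀ t ∈ Ioo 0 T, x₂ t ∈ Metric.ball (y t) ρ ∧ HasDerivAt x₂ (F t (x₂ t)) t) :
    W T (x₁ T - x₂ T) ≤ Real.exp (-(2 * κ) * T) * W 0 (x₁ 0 - x₂ 0) := by
  have hd : ∀ t ∈ Ioo 0 T, ∃ w, HasDerivAt (fun s => W s (x₁ s - x₂ s)) w t ∧
      w ≤ -(2 * κ) * W t (x₁ t - x₂ t) := fun t ht =>
    h.decay t ht.1 x₁ x₂ (h₁' t ht).1 (h₂' t ht).1 (h₁' t ht).2 (h₂' t ht).2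
  choose! w hw hw' using hd
  have hcont : ContinuousOn (fun s => W s (x₁ s - x₂ s)) (Icc 0 T) :=
    h.continuousOn.comp (f := fun s => (s, x₁ s - x₂ s)) (continuousOn_id.prodMk (h₁.sub h₂))
      (fun s hs => ⟨hs.1, mem_univ _⟩)
  have hanti : AntitoneOn (fun s => Real.exp (2 * κ * s) * W s (x₁ s - x₂ s)) (Icc 0 T) := by
    refine antitoneOn_of_hasDerivWithinAt_nonpos (convex_Icc 0 T)
      (f' := fun s => Real.exp (2 * κ * s) * (2 * κ) * W s (x₁ s - x₂ s) +
        Real.exp (2 * κ * s) * w s)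
      ((by fun_prop : Continuous fun s => Real.exp (2 * κ * s)).continuousOn.mul hcont) ?_ ?_
    · intro t ht
      rw [interior_Icc] at ht
      have he : HasDerivAt (fun s => Real.exp (2 * κ * s)) (Real.exp (2 * κ * t) * (2 * κ)) t := by
        simpa using ((hasDerivAt_id t).const_mul (2 * κ)).exp
      exact (he.mul (hw t ht)).hasDerivWithinAt
    · intro t ht
      rw [interior_Icc] at ht
      nlinarith [Real.exp_pos (2 * κ * t), hw' t ht]
  have := hanti (left_mem_Icc.2 hT) (right_mem_Icc.2 hT) hT
  simp only [mul_zero, Real.exp_zero, one_mul] at this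
  rw [neg_mul, Real.exp_neg, inv_mul_eq_div, le_div_iff₀ (Real.exp_pos _), mul_comm]
  exact this

/-- The `+ 1` in the constant only keeps it positive when `c₂ = 0`. -/
theorem norm_sub_le (h : IsIncrementalLyapunov F y ρ c₁ c₂ κ W) (hc₁ : 0 < c₁) (hc₂ : 0 ≤ c₂)
    {x₁ x₂ : ℝ → X} {T : ℝ}
    (hT : 0 ≤ T) (h₁ : ContinuousOn x₁ (Icc 0 T)) (h₂ : ContinuousOn x₂ (Icc 0 T))
    (h₁' : ∀ t ∈ Ioo 0 T, x₁ t ∈ Metric.ball (y t) ρ ∧ HasDerivAt x₁ (F t (x₁ t)) t)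
    (h₂' : ∀ t ∈ Ioo 0 T, x₂ t ∈ Metric.ball (y t) ρ ∧ HasDerivAt x₂ (F t (x₂ t)) t) :
    ‖x₁ T - x₂ T‖ ≤ (Real.sqrt (c₂ / c₁) + 1) * Real.exp (-κ * T) * ‖x₁ 0 - x₂ 0‖ := by
  have h3 := h.apply_le_exp_mul hT h₁ h₂ h₁' h₂'
  have h4 := h.lower T hT (x₁ T - x₂ T)
  have h5 := h.upper 0 le_rfl (x₁ 0 - x₂ 0)
  have hexp : Real.exp (-(2 * κ) * T) = Real.exp (-κ * T) ^ 2 := by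
    rw [← Real.exp_nat_mul]; congr 1; push_cast; ring
  have h6 : ‖x₁ T - x₂ T‖ ^ 2 ≤
      (Real.sqrt (c₂ / c₁) * Real.exp (-κ * T) * ‖x₁ 0 - x₂ 0‖) ^ 2 := by
    rw [mul_pow, mul_pow, Real.sq_sqrt (by positivity), ← hexp, div_mul_eq_mul_div,
      div_mul_eq_mul_div, le_div_iff₀ hc₁]
    calc ‖x₁ T - x₂ T‖ ^ 2 * c₁ ≤ Real.exp (-(2 * κ) * T) * W 0 (x₁ 0 - x₂ 0) := by linarith
      _ ≤ Real.exp (-(2 * κ) * T) * (c₂ * ‖x₁ 0 - x₂ 0‖ ^ 2) := by gcongr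
      _ = _ := by ring
  refine (abs_le_of_sq_le_sq' h6 (by positivity)).2.trans ?_
  gcongr
  linarith

/-- Solutions that start close enough to `y` do not leave the tube. -/
theorem mem_ball (h : IsIncrementalLyapunov F y ρ c₁ c₂ κ W) (hc₁ : 0 < c₁)
    (hρ : 0 < ρ) (hκ : 0 ≤ κ) (hy : IsSolution F y) {x : ℝ → X} {T : ℝ} (hT : 0 ≤ T)
    (hx : ContinuousOn x (Icc 0 T))
    (hx' : ∀ t ∈ Ioo 0 T, x t ∈ Metric.ball (y t) ρ → HasDerivAt x (F t (x t)) t)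
    (h0 : c₂ * ‖x 0 - y 0‖ ^ 2 < c₁ * ρ ^ 2) : x T ∈ Metric.ball (y T) ρ := by
  by_contra hcon
  have hycont : ContinuousOn y (Icc 0 T) := hy.continuousOn.mono fun t ht => ht.1
  have hnorm : ContinuousOn (fun t => ‖x t - y t‖) (Icc 0 T) := (hx.sub hycont).norm
  have hcomp : IsCompact {t ∈ Icc 0 T | ρ ≤ ‖x t - y t‖} := by
    have := hnorm.preimage_isClosed_of_isClosed isClosed_Icc (isClosed_Ici (a := ρ))
    exact isCompact_Icc.of_isClosed_subset this inter_subset_left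
  have hne : {t ∈ Icc 0 T | ρ ≤ ‖x t - y t‖}.Nonempty :=
    ⟨T, right_mem_Icc.2 hT, by simpa [dist_eq_norm] using hcon⟩
  -- At the first exit time `s`, decay on `[0, s]` gives `c₁ρ² ≤ W s ≤ W 0 < c₁ρ²`. The equation for
  -- `x` is used only inside the tube, so a truncated field is allowed.
  obtain ⟨s, ⟨hs, hsρ⟩, hmin⟩ := hcomp.exists_isLeast hne
  have hin : ∀ t ∈ Ioo 0 s, x t ∈ Metric.ball (y t) ρ := by
    intro t ht
    by_contra hnot
    have := hmin ⟨⟨ht.1.le, ht.2.le.trans hs.2⟩, by simpa [dist_eq_norm] using hnot⟩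
    exact absurd this (not_le.2 ht.2)
  have h3 := h.apply_le_exp_mul hs.1 (hx.mono (Icc_subset_Icc_right hs.2))
    (hycont.mono (Icc_subset_Icc_right hs.2))
    (fun t ht => ⟨hin t ht, hx' t ⟨ht.1, ht.2.trans_le hs.2⟩ (hin t ht)⟩)
    (fun t ht => ⟨Metric.mem_ball_self hρ, hy.hasDerivAt ht.1⟩)
  have h4 := h.lower s hs.1 (x s - y s)
  have h5 := h.upper 0 le_rfl (x 0 - y 0)
  have h6 : 0 ≤ W 0 (x 0 - y 0) := le_trans (by positivity) (h.lower 0 le_rfl _)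
  have h7 : Real.exp (-(2 * κ) * s) ≤ 1 := Real.exp_le_one_iff.2 (by nlinarith [hs.1])
  have h8 : c₁ * ρ ^ 2 ≤ c₁ * ‖x s - y s‖ ^ 2 := by gcongr
  have h9 := mul_le_of_le_one_left h6 h7
  linarith

theorem mem_ball_of_isSolution (h : IsIncrementalLyapunov F y ρ c₁ c₂ κ W) (hc₁ : 0 < c₁)
    (hρ : 0 < ρ) (hκ : 0 ≤ κ) (hy : IsSolution F y) {x : ℝ → X} (hx : IsSolution F x)
    (h0 : c₂ * ‖x 0 - y 0‖ ^ 2 < c₁ * ρ ^ 2) {t : ℝ} (ht : 0 ≤ t) :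
    x t ∈ Metric.ball (y t) ρ :=
  h.mem_ball hc₁ hρ hκ hy ht (hx.continuousOn.mono fun _ hs => hs.1)
    (fun _ hs _ => hx.hasDerivAt hs.1) h0

/-- A system with an incremental Lyapunov function in a tube around a solution is contracting
from a neighbourhood of the initial value of this solution. -/
theorem isContractingFrom [CompleteSpace X] (h : IsIncrementalLyapunov F y ρ c₁ c₂ κ W)
    (hc₁ : 0 < c₁) (hc₂ : 0 ≤ c₂) (hρ : 0 < ρ) (hκ : 0 < κ) (hy : IsSolution F y)
    (hF : ContinuousOn (Function.uncurry F) (Ici 0 ×ˢ univ)) {C L : NNReal}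
    (hC : ∀ t, 0 ≤ t → ∀ x ∈ Metric.closedBall (y t) ρ, ‖F t x‖ ≤ C)
    (hL : ∀ t, 0 ≤ t → LipschitzOnWith L (F t) (Metric.closedBall (y t) ρ))
    {S : Set X} (hS : ∀ x ∈ S, c₂ * ‖x - y 0‖ ^ 2 < c₁ * ρ ^ 2) : IsContractingFrom F S := by
  refine ⟨fun x₀ hx₀ => ?_, Real.sqrt (c₂ / c₁) + 1, κ, by positivity, hκ, ?_⟩
  · have hmax : ∀ t : ℝ, 0 ≤ max t 0 := fun t => le_max_right _ _
    have hproj : ∀ t x, y (max t 0) + radialRetraction ρ (x - y (max t 0)) ∈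
        Metric.closedBall (y (max t 0)) ρ := fun t x => by
      simpa [mem_closedBall_iff_norm] using norm_radialRetraction_le hρ (x - y (max t 0))
    have hretr : Continuous (radialRetraction ρ : X → X) :=
      (LipschitzWith.of_dist_le_mul (K := 2) fun u v => by
        simpa [dist_eq_norm] using norm_radialRetraction_sub_le hρ u v).continuous
    have hyc : Continuous fun t => y (max t 0) :=
      hy.continuousOn.comp_continuous (by fun_prop) hmax
    -- The field is made global by retracting the state onto the tube and freezing time at `0` for
    -- `t < 0`. The solution never leaves the tube, so there it solves the original equation.
    obtain ⟨x, hx0, hx⟩ := exists_isSolution_of_bounded_lipschitz (C := C) (L := L * 2)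
      (F := fun t x => F (max t 0) (y (max t 0) + radialRetraction ρ (x - y (max t 0))))
      (fun t x => hC _ (hmax t) _ (hproj t x))
      (fun t => LipschitzWith.of_dist_le_mul fun u v => by
        refine ((hL _ (hmax t)).dist_le_mul _ (hproj t u) _ (hproj t v)).trans ?_
        push_cast
        rw [mul_assoc]
        gcongr
        have := norm_radialRetraction_sub_le hρ (u - y (max t 0)) (v - y (max t 0))
        simpa [dist_eq_norm] using this)
      (fun x => hF.comp_continuous
        (f := fun t => (max t 0, y (max t 0) + radialRetraction ρ (x - y (max t 0))))
        ((continuous_id.max continuous_const).prodMk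
          (hyc.add (hretr.comp (continuous_const.sub hyc)))) fun t => ⟨hmax t, mem_univ _⟩) x₀
    have hval : ∀ t, 0 ≤ t → x t ∈ Metric.ball (y t) ρ →
        F (max t 0) (y (max t 0) + radialRetraction ρ (x t - y (max t 0))) = F t (x t) := by
      intro t ht hxt
      rw [max_eq_left ht, radialRetraction_of_norm_le hρ (mem_ball_iff_norm.1 hxt).le]
      congr 1
      abel
    have hmem : ∀ t, 0 ≤ t → x t ∈ Metric.ball (y t) ρ := by
      intro t ht
      refine h.mem_ball hc₁ hρ hκ.le hy ht (hx.continuousOn.mono fun _ hs => hs.1)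
        (fun s hs hxs => ?_) (by rw [hx0]; exact hS x₀ hx₀)
      have := hx.hasDerivAt hs.1
      simp only [hval s hs.1.le hxs] at this
      exact this
    refine ⟨x, hx0, fun t ht => ?_⟩
    have := hx t ht
    simp only [hval t ht (hmem t ht)] at this
    exact this
  · intro x₁ x₂ h₁ h₂ hS₁ hS₂ t ht
    exact h.norm_sub_le hc₁ hc₂ ht (h₁.continuousOn.mono fun _ hs => hs.1)
      (h₂.continuousOn.mono fun _ hs => hs.1)
      (fun s hs => ⟨h.mem_ball_of_isSolution hc₁ hρ hκ.le hy h₁ (hS _ hS₁) hs.1.le,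
        h₁.hasDerivAt hs.1⟩)
      (fun s hs => ⟨h.mem_ball_of_isSolution hc₁ hρ hκ.le hy h₂ (hS _ hS₂) hs.1.le,
        h₂.hasDerivAt hs.1⟩)

end IsIncrementalLyapunov

end Ode

end CCM

namespace CCM

/-! ### A quadratic form that is negative on a subspace -/

section Quadratic

variable {E : Type*} [NormedAddCommGroup E] [InnerProductSpace ℝ E]

theorem sq_inner_add_sq_inner_le {e₀ e₁ : E} (h₀ : ‖e₀‖ = 1) (h₁ : ‖e₁‖ = 1)
    (h : ⟪e₀, e₁⟫_ℝ = 0) (w : E) : ⟪e₀, w⟫_ℝ ^ 2 + ⟪e₁, w⟫_ℝ ^ 2 ≤ ‖w‖ ^ 2 := by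
  have hv : Orthonormal ℝ ![e₀, e₁] := by
    rw [orthonormal_iff_ite]
    simp [Fin.forall_fin_two, h₀, h₁, h, real_inner_comm e₀ e₁]
  simpa using hv.sum_inner_products_le (x := w) (s := Finset.univ)

/-- A symmetric operator that is negative definite on a nontrivial subspace becomes negative
definite after subtracting a multiple of its squared norm on the orthogonal complement. -/
theorem inner_apply_add_le {D : E →L[ℝ] E} (hD : ∀ x y, ⟪D x, y⟫_ℝ = ⟪x, D y⟫_ℝ)
    {S : Submodule ℝ E} (hS : S ≠ ⊥) {q θ : ℝ} (hq : 0 < q) (hθ : 1 ≤ θ)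
    (hneg : ∀ v ∈ S, ⟪v, D v⟫_ℝ ≤ -q * ‖v‖ ^ 2) {v₀ v₁ : E} (h₀ : v₀ ∈ S)
    (h₁ : ∀ v ∈ S, ⟪v, v₁⟫_ℝ = 0) :
    ⟪v₀ + v₁, D (v₀ + v₁)⟫_ℝ ≤
      -(q * (1 - 1 / θ)) * ‖v₀‖ ^ 2 + θ * ‖D‖ ^ 2 / q * ‖v₁‖ ^ 2 := by
  have hθ0 : 0 < θ := by linarith
  rcases eq_or_ne v₁ 0 with rfl | hv₁
  · have h := hneg v₀ h₀
    have h2 : 0 ≤ q * (1 / θ) * ‖v₀‖ ^ 2 := by positivity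
    simp only [add_zero, norm_zero]
    nlinarith
  -- Reduction to a 2 × 2 matrix with entries `a`, `b`, `c`. If `v₀ = 0`, any unit vector of `S`
  -- serves; this is where `S ≠ ⊥` enters.
  obtain ⟨e₀, s₀, he₀S, he₀, rfl⟩ : ∃ e₀, ∃ s₀ : ℝ, e₀ ∈ S ∧ ‖e₀‖ = 1 ∧ v₀ = s₀ • e₀ := by
    have key : ∀ v ∈ S, v ≠ 0 → ∃ e₀, ∃ s₀ : ℝ, e₀ ∈ S ∧ ‖e₀‖ = 1 ∧ v = s₀ • e₀ := by
      intro v hv hne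
      have hn : ‖v‖ ≠ 0 := norm_ne_zero_iff.2 hne
      exact ⟨‖v‖⁻¹ • v, ‖v‖, S.smul_mem _ hv, norm_smul_inv_norm hne, by
        rw [smul_smul, mul_inv_cancel₀ hn, one_smul]⟩
    rcases eq_or_ne v₀ 0 with rfl | hne
    · obtain ⟨v, hv, hne⟩ := S.exists_mem_ne_zero_of_ne_bot hS
      obtain ⟨e₀, _, h1, h2, _⟩ := key v hv hne
      exact ⟨e₀, 0, h1, h2, by simp⟩
    · exact key v₀ h₀ hne
  obtain ⟨e₁, s₁, he₁, rfl⟩ : ∃ e₁ : E, ∃ s₁ : ℝ, ‖e₁‖ = 1 ∧ v₁ = s₁ • e₁ :=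
    ⟨‖v₁‖⁻¹ • v₁, ‖v₁‖, norm_smul_inv_norm hv₁, by
      rw [smul_smul, mul_inv_cancel₀ (norm_ne_zero_iff.2 hv₁), one_smul]⟩
  have hs₁ : s₁ ≠ 0 := fun h => hv₁ (by simp [h])
  have horth : ⟪e₀, e₁⟫_ℝ = 0 := by
    have := h₁ e₀ he₀S
    rw [inner_smul_right] at this
    exact (mul_eq_zero.1 this).resolve_left hs₁
  have hDle : ∀ e : E, ‖e‖ = 1 → ‖D e‖ ^ 2 ≤ ‖D‖ ^ 2 := fun e he => by
    have := D.le_opNorm e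
    rw [he, mul_one] at this
    gcongr
  have hsym : ⟪e₁, D e₀⟫_ℝ = ⟪e₀, D e₁⟫_ℝ := by rw [← hD, real_inner_comm]
  have hb₀ := (sq_inner_add_sq_inner_le he₀ he₁ horth (D e₀)).trans (hDle e₀ he₀)
  have hb₁ := (sq_inner_add_sq_inner_le he₀ he₁ horth (D e₁)).trans (hDle e₁ he₁)
  rw [hsym] at hb₀
  have ha := hneg e₀ he₀S
  rw [he₀] at ha
  have hexp : ⟪s₀ • e₀ + s₁ • e₁, D (s₀ • e₀ + s₁ • e₁)⟫_ℝ =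
      s₀ ^ 2 * ⟪e₀, D e₀⟫_ℝ + 2 * (s₀ * s₁ * ⟪e₀, D e₁⟫_ℝ) + s₁ ^ 2 * ⟪e₁, D e₁⟫_ℝ := by
    simp only [map_add, map_smul, inner_add_left, inner_add_right, real_inner_smul_left,
      real_inner_smul_right, hsym]
    ring
  rw [hexp, norm_smul, norm_smul, he₀, he₁, mul_one, mul_one, Real.norm_eq_abs, Real.norm_eq_abs,
    sq_abs, sq_abs]
  generalize ⟪e₀, D e₀⟫_ℝ = a at *
  generalize ⟪e₀, D e₁⟫_ℝ = b at *
  generalize ⟪e₁, D e₁⟫_ℝ = c at *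
  generalize ‖D‖ = d at *
  -- This avoids a separate `‖D‖` term for the block `c`: if `q ≤ c`, then `cq ≤ c²` and the second
  -- row bounds `b² + c²`; otherwise `cq ≤ q² ≤ a²` and the first row bounds `a² + b²`.
  have hbc : b ^ 2 + c * q ≤ d ^ 2 := by
    rcases le_total q c with hc | hc
    · nlinarith
    · nlinarith
  have hc : c + θ * b ^ 2 / q ≤ θ * d ^ 2 / q := by
    rw [← sub_nonneg]
    have : θ * d ^ 2 / q - (c + θ * b ^ 2 / q) =
        ((d ^ 2 - b ^ 2 - c * q) + (θ - 1) * (d ^ 2 - b ^ 2)) / q := by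
      field_simp
      ring
    rw [this]
    exact div_nonneg (add_nonneg (by linarith) (mul_nonneg (by linarith) (by nlinarith))) hq.le
  have hyoung : 2 * (s₀ * s₁ * b) ≤ q / θ * s₀ ^ 2 + θ * b ^ 2 / q * s₁ ^ 2 := by
    rw [← sub_nonneg]
    have : q / θ * s₀ ^ 2 + θ * b ^ 2 / q * s₁ ^ 2 - 2 * (s₀ * s₁ * b) =
        (q * s₀ - θ * b * s₁) ^ 2 / (θ * q) := by
      field_simp
      ring
    rw [this]
    positivity
  have h1 : s₀ ^ 2 * a ≤ s₀ ^ 2 * (-q) :=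
    mul_le_mul_of_nonneg_left (by linarith) (sq_nonneg _)
  have h2 := mul_le_mul_of_nonneg_right hc (sq_nonneg s₁)
  have h3 : -(q * (1 - 1 / θ)) * s₀ ^ 2 = s₀ ^ 2 * (-q) + q / θ * s₀ ^ 2 := by
    field_simp
    ring
  rw [h3]
  linarith

end Quadratic

/-! ### Symmetry, drift form and Killing identity of the metric -/

section Metric

variable {n m : ℕ} {f : Vec n → Vec n} {B : Vec n → (Vec m →L[ℝ] Vec n)}
  {M : Vec n → (Vec n →L[ℝ] Vec n)} {plow pup lam : ℝ}

namespace IsControlContractionMetric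

theorem inner_apply_comm (hM : IsControlContractionMetric f B M plow pup lam) (x v w : Vec n) :
    ⟪M x v, w⟫_ℝ = ⟪v, M x w⟫_ℝ := by
  rw [← ContinuousLinearMap.adjoint_inner_right,
    ContinuousLinearMap.isSelfAdjoint_iff'.1 (hM.symm x)]

theorem injective (hM : IsControlContractionMetric f B M plow pup lam) (x : Vec n) :
    Function.Injective (M x) := by
  refine (injective_iff_map_eq_zero _).2 fun v hv => ?_
  have h := hM.lower x v
  rw [hv, inner_zero_right] at h
  have h2 : ‖v‖ ^ 2 ≤ 0 := nonpos_of_mul_nonpos_right h hM.plow_pos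
  exact norm_eq_zero.1 (pow_eq_zero_iff two_ne_zero |>.1 (le_antisymm h2 (sq_nonneg _)))

theorem differentiable (hM : IsControlContractionMetric f B M plow pup lam) :
    Differentiable ℝ M :=
  hM.smooth.differentiable (by simp)

/-- Obtained by differentiating the symmetry identity of `M`. -/
theorem inner_fderiv_comm (hM : IsControlContractionMetric f B M plow pup lam)
    (x h v w : Vec n) : ⟪fderiv ℝ M x h v, w⟫_ℝ = ⟪v, fderiv ℝ M x h w⟫_ℝ := by
  have hd : ∀ u, HasFDerivAt (fun y => M y u) ((fderiv ℝ M x).flip u) x := fun u =>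
    ((hM.differentiable x).hasFDerivAt).clm_apply (hasFDerivAt_const u x) |>.congr_fderiv (by
      ext; simp)
  have h1 := (hd v).inner ℝ (hasFDerivAt_const w x)
  have h2 := (hasFDerivAt_const v x).inner ℝ (hd w)
  have h3 : (fun y => ⟪M y v, w⟫_ℝ) = fun y => ⟪v, M y w⟫_ℝ :=
    funext fun y => hM.inner_apply_comm y v w
  rw [h3] at h1
  have := congrArg (fun A => A h) (h1.unique h2)
  simpa [fderivInnerCLM_apply] using this

theorem inner_driftForm (hM : IsControlContractionMetric f B M plow pup lam) (x v w : Vec n) :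
    ⟪v, driftForm f M x w⟫_ℝ = ⟪v, fderiv ℝ M x (f x) w⟫_ℝ +
      (⟪M x (fderiv ℝ f x v), w⟫_ℝ + ⟪v, M x (fderiv ℝ f x w)⟫_ℝ) := by
  simp [driftForm, inner_add_right, ContinuousLinearMap.adjoint_inner_right, hM.inner_apply_comm]

theorem driftForm_symm (hM : IsControlContractionMetric f B M plow pup lam) (x v w : Vec n) :
    ⟪driftForm f M x v, w⟫_ℝ = ⟪v, driftForm f M x w⟫_ℝ := by
  rw [real_inner_comm, hM.inner_driftForm, hM.inner_driftForm, ← hM.inner_fderiv_comm,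
    real_inner_comm v, real_inner_comm v (M x _), real_inner_comm _ w]
  ring

theorem inner_driftForm_le (hM : IsControlContractionMetric f B M plow pup lam) (x v : Vec n)
    (hv : ∀ w : Vec m, ⟪v, M x (B x w)⟫_ℝ = 0) :
    ⟪v, driftForm f M x v⟫_ℝ ≤ -(lam * plow) * ‖v‖ ^ 2 := by
  rcases eq_or_ne v 0 with rfl | hne
  · simp
  have h := hM.contracting x v hne hv
  have h2 := mul_le_mul_of_nonneg_left (hM.lower x v) hM.lam_pos.le
  rw [inner_add_right, real_inner_smul_right] at h
  have h3 : ⟪M x (fderiv ℝ f x v), v⟫_ℝ = ⟪v, M x (fderiv ℝ f x v)⟫_ℝ := real_inner_comm _ _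
  rw [hM.inner_driftForm, h3]
  linarith

/-- The Killing condition removes the input from the derivative of the metric. -/
theorem killing_apply (hM : IsControlContractionMetric f B M plow pup lam)
    (hB : Differentiable ℝ B) (x v : Vec n) (u : Vec m) :
    ⟪v, fderiv ℝ M x (B x u) v⟫_ℝ + 2 * ⟪v, M x (fderiv ℝ B x v u)⟫_ℝ = 0 := by
  have hcol : ∀ i, fderiv ℝ (fun y => B y (stdBasis i)) x v = fderiv ℝ B x v (stdBasis i) := by
    intro i
    have := ((hB x).hasFDerivAt).clm_apply (hasFDerivAt_const (stdBasis i) x)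
    rw [this.fderiv]
    simp
  have hi : ∀ i, ⟪v, fderiv ℝ M x (B x (stdBasis i)) v⟫_ℝ +
      2 * ⟪v, M x (fderiv ℝ B x v (stdBasis i))⟫_ℝ = 0 := by
    intro i
    have := congrArg (fun A : Vec n →L[ℝ] Vec n => ⟪v, A v⟫_ℝ) (hM.killing x i)
    simp only [add_apply, ContinuousLinearMap.comp_apply, inner_add_right,
      ContinuousLinearMap.adjoint_inner_right, hcol, zero_apply,
      inner_zero_right] at this
    have h2 : ⟪fderiv ℝ B x v (stdBasis i), M x v⟫_ℝ =
        ⟪v, M x (fderiv ℝ B x v (stdBasis i))⟫_ℝ := by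
      rw [← hM.inner_apply_comm, real_inner_comm]
    linarith
  -- The identity is linear in `u`, so the columns of `B` suffice.
  have hu : u = ∑ i, u i • (stdBasis i : Vec m) := by
    simpa [stdBasis] using ((EuclideanSpace.basisFun (Fin m) ℝ).sum_repr u).symm
  rw [hu]
  simp only [map_sum, map_smul, sum_apply, smul_apply,
    inner_sum, real_inner_smul_right, Finset.mul_sum]
  rw [← Finset.sum_add_distrib]
  refine Finset.sum_eq_zero fun i _ => ?_
  linear_combination u i * hi i

end IsControlContractionMetric

end Metric

/-! ### The gain and the contraction of the linearization -/

section Gain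

variable {n m : ℕ}

theorem isInvertible_adjoint_comp_self {N : Vec m →L[ℝ] Vec n} (hN : Function.Injective N) :
    ((ContinuousLinearMap.adjoint N) ∘L N).IsInvertible := by
  have hinj : Function.Injective ((ContinuousLinearMap.adjoint N) ∘L N) := by
    refine (injective_iff_map_eq_zero _).2 fun v hv => hN ?_
    have h : ⟪v, ((ContinuousLinearMap.adjoint N) ∘L N) v⟫_ℝ = 0 := by rw [hv, inner_zero_right]
    rw [ContinuousLinearMap.comp_apply, ContinuousLinearMap.adjoint_inner_right,
      inner_self_eq_zero] at h
    rw [h, map_zero]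
  exact ⟨(LinearEquiv.ofInjectiveEndo _ hinj).toContinuousLinearEquiv, by ext; rfl⟩

variable {f : Vec n → Vec n} {B : Vec n → (Vec m →L[ℝ] Vec n)}
  {M : Vec n → (Vec n →L[ℝ] Vec n)} {plow pup lam : ℝ}

/-- Decomposition of `v` along the range of `N` and its orthogonal complement. -/
theorem exists_decomposition {N : Vec m →L[ℝ] Vec n} (hN : Function.Injective N) (v : Vec n) :
    ∃ v₀ v₁ : Vec n, v = v₀ + v₁ ∧ (∀ w, ⟪v₀, N w⟫_ℝ = 0) ∧ v₁ ∈ N.range ∧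
      N (ContinuousLinearMap.inverse ((ContinuousLinearMap.adjoint N) ∘L N)
        (ContinuousLinearMap.adjoint N v)) = v₁ := by
  set r := ContinuousLinearMap.inverse ((ContinuousLinearMap.adjoint N) ∘L N)
    (ContinuousLinearMap.adjoint N v) with hr
  refine ⟨v - N r, N r, by abel, fun w => ?_, ⟨r, rfl⟩, rfl⟩
  have h : ContinuousLinearMap.adjoint N (N r) = ContinuousLinearMap.adjoint N v := by
    have := (isInvertible_adjoint_comp_self hN).self_apply_inverse (ContinuousLinearMap.adjoint N v)
    exact this
  rw [← ContinuousLinearMap.adjoint_inner_left, map_sub, h, sub_self, inner_zero_left]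

/-- Along the target trajectory, the closed-loop linearization contracts the metric. -/
theorem IsControlContractionMetric.inner_linearization_le
    (hM : IsControlContractionMetric f B M plow pup lam) (hmn : m < n)
    (hB : Differentiable ℝ B) (hBrank : ∀ x, Function.Injective (B x))
    {r : ℝ} (hr : 1 / (2 * lam) < r) {γ : Vec n → ℝ}
    (hγ : ∀ x, r / plow * ‖driftForm f M x‖ ^ 2 ≤ γ x) (γ₀ : ℝ)
    (x v : Vec n) (u : Vec m) :
    ⟪v, fderiv ℝ M x (f x + B x u) v⟫_ℝ +
      2 * ⟪v, M x (fderiv ℝ f x v + fderiv ℝ B x v u + B x (gain B M γ γ₀ x v))⟫_ℝ ≤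
    -(min (lam * plow * (1 - 1 / (2 * r * lam))) (2 * γ₀)) * ‖v‖ ^ 2 := by
  have hlam := hM.lam_pos
  have hplow := hM.plow_pos
  set N : Vec m →L[ℝ] Vec n := (M x) ∘L (B x) with hNdef
  have hN : Function.Injective N := (hM.injective x).comp (hBrank x)
  obtain ⟨v₀, v₁, hv, hv₀, ⟨s, hs⟩, hproj⟩ := exists_decomposition hN v
  have h01 : ⟪v₀, v₁⟫_ℝ = 0 := hs ▸ hv₀ s
  -- `N (NᵀN)⁻¹ Nᵀ` is the orthogonal projection onto the range of `N = MB`.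
  have hgain : ⟪v, M x (B x (gain B M γ γ₀ x v))⟫_ℝ = -(γ x + γ₀) * ‖v₁‖ ^ 2 := by
    have h1 : M x (B x (gain B M γ γ₀ x v)) = (-(γ x + γ₀)) • v₁ := by
      rw [← hproj]
      simp [gain, damping, hNdef]
    rw [h1, real_inner_smul_right, hv, inner_add_left, h01, zero_add, real_inner_self_eq_norm_sq]
  have hnorm : ‖v‖ ^ 2 = ‖v₀‖ ^ 2 + ‖v₁‖ ^ 2 := by
    rw [hv, norm_add_sq_real, h01]; ring
  -- With this weight the `v₁` term of `inner_apply_add_le` is exactly twice the lower bound for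
  -- `γ`; `θ > 1` is the condition on `r`.
  set θ := 2 * r * lam with hθdef
  have hθ : 1 < θ := by
    rw [div_lt_iff₀ (by positivity)] at hr
    linarith
  -- Here `m < n` is needed: some direction is not actuated.
  have hker : (ContinuousLinearMap.adjoint N).ker ≠ ⊥ := by
    refine LinearMap.ker_ne_bot_of_finrank_lt ?_
    simpa using hmn
  have hmem : ∀ w : Vec n, w ∈ (ContinuousLinearMap.adjoint N).ker → ∀ a, ⟪w, N a⟫_ℝ = 0 := by
    intro w hw a
    have hw' : ContinuousLinearMap.adjoint N w = 0 := hw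
    rw [← ContinuousLinearMap.adjoint_inner_left, hw', inner_zero_left]
  have hD := inner_apply_add_le (D := driftForm f M x) (hM.driftForm_symm x) hker
    (mul_pos hlam hplow) hθ.le (fun w hw => hM.inner_driftForm_le x w (hmem w hw))
    (v₀ := v₀) (v₁ := v₁)
    (show ContinuousLinearMap.adjoint N v₀ = 0 from ext_inner_right ℝ fun a => by
      rw [ContinuousLinearMap.adjoint_inner_left, hv₀, inner_zero_left])
    (fun w hw => hs ▸ hmem w hw s)
  rw [← hv] at hD
  have hθD : θ * ‖driftForm f M x‖ ^ 2 / (lam * plow) = 2 * (r / plow * ‖driftForm f M x‖ ^ 2) := by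
    rw [hθdef]
    field_simp
  rw [hθD] at hD
  have hkill := hM.killing_apply hB x v u
  have hsym : ⟪M x (fderiv ℝ f x v), v⟫_ℝ = ⟪v, M x (fderiv ℝ f x v)⟫_ℝ := real_inner_comm _ _
  rw [hM.inner_driftForm, hsym] at hD
  simp only [map_add, add_apply, inner_add_right, hgain]
  have h1 := mul_le_mul_of_nonneg_right (hγ x) (sq_nonneg ‖v₁‖)
  have h2 := mul_le_mul_of_nonneg_right
    (min_le_left (lam * plow * (1 - 1 / θ)) (2 * γ₀)) (sq_nonneg ‖v₀‖)
  have h3 := mul_le_mul_of_nonneg_right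
    (min_le_right (lam * plow * (1 - 1 / θ)) (2 * γ₀)) (sq_nonneg ‖v₁‖)
  rw [hnorm]
  linarith

end Gain

end CCM

namespace CCM

/-! ### Uniform bounds on balls -/

section LocalBounds

theorem exists_norm_le_of_continuous {E G : Type*} [NormedAddCommGroup E] [ProperSpace E]
    [NormedAddCommGroup G] {g : E → G} (hg : Continuous g) (R : ℝ) :
    ∃ C, 0 ≤ C ∧ ∀ x, ‖x‖ ≤ R → ‖g x‖ ≤ C := by
  obtain ⟨C, hC⟩ := (isCompact_closedBall (0 : E) R).exists_bound_of_continuousOn hg.continuousOn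
  exact ⟨max C 0, le_max_right _ _, fun x hx =>
    (hC x (mem_closedBall_zero_iff.2 hx)).trans (le_max_left _ _)⟩

variable {E G : Type*} [NormedAddCommGroup E] [NormedSpace ℝ E] [ProperSpace E]
  [NormedAddCommGroup G] [NormedSpace ℝ G]

theorem exists_norm_sub_le_of_contDiff {g : E → G} (hg : ContDiff ℝ 1 g) (R : ℝ) :
    ∃ C, 0 ≤ C ∧ ∀ x y, ‖x‖ ≤ R → ‖y‖ ≤ R → ‖g x - g y‖ ≤ C * ‖x - y‖ := by
  obtain ⟨C, hC0, hC⟩ := exists_norm_le_of_continuous (hg.continuous_fderiv one_ne_zero) R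
  exact ⟨C, hC0, fun x y hx hy => (convex_closedBall (0 : E) R).norm_image_sub_le_of_norm_fderiv_le
    (fun z _ => hg.differentiable one_ne_zero z)
    (fun z hz => hC z (mem_closedBall_zero_iff.1 hz))
    (mem_closedBall_zero_iff.2 hy) (mem_closedBall_zero_iff.2 hx)⟩

/-- Mean value inequality for `g - g'(w)`, whose derivative is at most `Cρ` on the ball around `w`
because `g'` is Lipschitz. -/
theorem exists_norm_sub_sub_fderiv_le {g : E → G} (hg : ContDiff ℝ 2 g) (R : ℝ) :
    ∃ C, 0 ≤ C ∧ ∀ ρ w x y, 0 ≤ ρ → ‖w‖ + ρ ≤ R → ‖x - w‖ ≤ ρ → ‖y - w‖ ≤ ρ →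
      ‖g x - g y - fderiv ℝ g w (x - y)‖ ≤ C * ρ * ‖x - y‖ := by
  obtain ⟨C, hC0, hC⟩ := exists_norm_sub_le_of_contDiff
    (hg.fderiv_right (m := 1) (by norm_num)) R
  refine ⟨C, hC0, fun ρ w x y hρ hw hx hy => ?_⟩
  refine (convex_closedBall w ρ).norm_image_sub_le_of_norm_fderiv_le' (𝕜 := ℝ)
    (fun z _ => hg.differentiable two_ne_zero z) (fun z hz => ?_)
    (mem_closedBall_iff_norm.2 hy) (mem_closedBall_iff_norm.2 hx)
  rw [mem_closedBall_iff_norm] at hz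
  have hz' : ‖z‖ ≤ R := by
    have := norm_add_le (z - w) w
    rw [sub_add_cancel] at this
    linarith
  refine (hC z w hz' (by linarith)).trans ?_
  gcongr

end LocalBounds

/-! ### Increments of `β` -/

section PartialIntegral

variable {n m : ℕ}

theorem toLp_update_eq (z : Vec n) (i : Fin n) (c : ℝ) :
    WithLp.toLp 2 (Function.update (WithLp.ofLp z) i c) = z + (c - z i) • (stdBasis i : Vec n) := by
  ext j
  rcases eq_or_ne j i with rfl | hj
  · simp [stdBasis]
  · simp [stdBasis, hj]

theorem norm_stdBasis (i : Fin n) : ‖(stdBasis i : Vec n)‖ = 1 := by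
  simp [stdBasis]

theorem abs_apply_le_norm (v : Vec n) (i : Fin n) : |v i| ≤ ‖v‖ :=
  PiLp.norm_apply_le v i

variable {K : Vec n → (Vec n →L[ℝ] Vec m)}

theorem continuous_toLp_update (z : Vec n) (i : Fin n) :
    Continuous fun c : ℝ => WithLp.toLp 2 (Function.update (WithLp.ofLp z) i c) := by
  simp only [toLp_update_eq]
  fun_prop

theorem continuous_partialIntegral (hK : Continuous K) :
    Continuous fun p : Vec n × Vec n => partialIntegral K p.1 p.2 := by
  unfold partialIntegral
  refine continuous_finsetSum _ fun i _ => ?_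
  refine intervalIntegral.continuous_parametric_intervalIntegral_of_continuous
    (f := fun (p : Vec n × Vec n) (c : ℝ) =>
      K (WithLp.toLp 2 (Function.update (WithLp.ofLp p.2) i c)) (stdBasis i)) ?_ (by fun_prop)
  simp only [toLp_update_eq]
  exact (hK.comp (by fun_prop)).clm_apply continuous_const

theorem partialIntegral_sub (hK : Continuous K) (x y z : Vec n) :
    partialIntegral K x z - partialIntegral K y z = ∑ i : Fin n, ∫ μ in (y i)..(x i),
      K (WithLp.toLp 2 (Function.update (WithLp.ofLp z) i μ)) (stdBasis i) := by
  rw [partialIntegral, partialIntegral, ← Finset.sum_sub_distrib]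
  refine Finset.sum_congr rfl fun i _ => ?_
  have hc : Continuous fun μ : ℝ =>
      K (WithLp.toLp 2 (Function.update (WithLp.ofLp z) i μ)) (stdBasis i) :=
    (hK.comp (continuous_toLp_update z i)).clm_apply continuous_const
  exact intervalIntegral.integral_interval_sub_left (hc.intervalIntegrable _ _)
    (hc.intervalIntegrable _ _)

/-- `z` is within `ρ` of `w`, and the replaced coordinate moves by at most `2ρ`. -/
theorem norm_toLp_update_sub_le {w z : Vec n} {ρ c : ℝ} {i : Fin n} (hz : ‖z - w‖ ≤ ρ)
    (hc : |c - w i| ≤ ρ) :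
    ‖WithLp.toLp 2 (Function.update (WithLp.ofLp z) i c) - w‖ ≤ 3 * ρ := by
  rw [toLp_update_eq]
  have h1 := norm_add_le (z - w) ((c - z i) • (stdBasis i : Vec n))
  rw [norm_smul, norm_stdBasis, mul_one, Real.norm_eq_abs] at h1
  have h2 := abs_apply_le_norm (z - w) i
  have h3 : |c - z i| ≤ |c - w i| + |(z - w) i| := by
    have : c - z i = (c - w i) - (z - w) i := by simp
    rw [this]
    exact abs_sub _ _
  have h4 : z + (c - z i) • (stdBasis i : Vec n) - w = z - w + (c - z i) • stdBasis i := by abel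
  rw [h4]
  linarith

theorem abs_sub_le_of_mem_uIoc {w x y : Vec n} {ρ c : ℝ} {i : Fin n} (hx : ‖x - w‖ ≤ ρ)
    (hy : ‖y - w‖ ≤ ρ) (hc : c ∈ uIoc (y i) (x i)) : |c - w i| ≤ ρ := by
  have h1 := (abs_apply_le_norm (x - w) i).trans hx
  have h2 := (abs_apply_le_norm (y - w) i).trans hy
  simp only [PiLp.sub_apply, abs_le] at h1 h2
  rw [abs_le]
  rcases mem_uIoc.1 hc with h | h <;> constructor <;> linarith [h.1, h.2]

theorem norm_toLp_update_sub_toLp_update_le (z z' : Vec n) (i : Fin n) (c : ℝ) :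
    ‖WithLp.toLp 2 (Function.update (WithLp.ofLp z) i c) -
      WithLp.toLp 2 (Function.update (WithLp.ofLp z') i c)‖ ≤ 2 * ‖z - z'‖ := by
  rw [toLp_update_eq, toLp_update_eq]
  have h4 : z + (c - z i) • (stdBasis i : Vec n) - (z' + (c - z' i) • stdBasis i) =
      (z - z') - ((z - z') i) • stdBasis i := by
    simp only [PiLp.sub_apply, sub_smul]
    abel
  rw [h4]
  refine (norm_sub_le _ _).trans ?_
  rw [norm_smul, norm_stdBasis, mul_one, Real.norm_eq_abs]
  linarith [abs_apply_le_norm (z - z') i]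

variable {L R : ℝ}

/-- In this sense `K w` is the `x`-derivative of `β` near `x = z = w`: both terms are sums of
integrals over the segments from `y i` to `x i`, and the integrands differ by at most `3Lρ`. -/
theorem norm_partialIntegral_sub_sub_le (hK : Continuous K) (hL : 0 ≤ L)
    (hlip : ∀ x y, ‖x‖ ≤ R → ‖y‖ ≤ R → ‖K x - K y‖ ≤ L * ‖x - y‖) {ρ : ℝ} (hρ : 0 ≤ ρ)
    {w x y z : Vec n} (hw : ‖w‖ + 3 * ρ ≤ R) (hx : ‖x - w‖ ≤ ρ) (hy : ‖y - w‖ ≤ ρ)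
    (hz : ‖z - w‖ ≤ ρ) :
    ‖partialIntegral K x z - partialIntegral K y z - K w (x - y)‖ ≤
      n * (3 * L) * ρ * ‖x - y‖ := by
  have hsum : K w (x - y) = ∑ i : Fin n, ∫ _ in (y i)..(x i), K w (stdBasis i) := by
    have hxy : x - y = ∑ i, (x - y) i • (stdBasis i : Vec n) := by
      simpa [stdBasis] using ((EuclideanSpace.basisFun (Fin n) ℝ).sum_repr (x - y)).symm
    conv_lhs => rw [hxy]
    simp
  rw [partialIntegral_sub hK, hsum, ← Finset.sum_sub_distrib]
  have hterm : ∀ i ∈ (Finset.univ : Finset (Fin n)),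
      ‖(∫ μ in (y i)..(x i), K (WithLp.toLp 2 (Function.update (WithLp.ofLp z) i μ)) (stdBasis i)) -
        ∫ _ in (y i)..(x i), K w (stdBasis i)‖ ≤ L * (3 * ρ) * ‖x - y‖ := by
    intro i _
    have hc : Continuous fun μ : ℝ =>
        K (WithLp.toLp 2 (Function.update (WithLp.ofLp z) i μ)) (stdBasis i) :=
      (hK.comp (continuous_toLp_update z i)).clm_apply continuous_const
    rw [← intervalIntegral.integral_sub (hc.intervalIntegrable _ _)
      intervalIntegrable_const]
    refine (intervalIntegral.norm_integral_le_of_norm_le_const (C := L * (3 * ρ))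
      fun μ hμ => ?_).trans ?_
    · have h3 := norm_toLp_update_sub_le hz (abs_sub_le_of_mem_uIoc hx hy hμ)
      rw [← sub_apply]
      refine ((K _ - K w).le_opNorm _).trans ?_
      rw [norm_stdBasis, mul_one]
      refine (hlip _ _ ?_ (by linarith)).trans (by gcongr)
      have := norm_add_le
        (WithLp.toLp 2 (Function.update (WithLp.ofLp z) i μ) - w) w
      rw [sub_add_cancel] at this
      linarith
    · have := abs_apply_le_norm (x - y) i
      rw [PiLp.sub_apply] at this
      gcongr
  refine (norm_sum_le_of_le _ hterm).trans (le_of_eq ?_)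
  simp
  ring

/-- The dependence on `z` is of second order: the integrands change by at most `2L‖z - z'‖`, and the
segments have length at most `ρ`. -/
theorem norm_partialIntegral_sub_sub_sub_le (hK : Continuous K) (hL : 0 ≤ L)
    (hlip : ∀ x y, ‖x‖ ≤ R → ‖y‖ ≤ R → ‖K x - K y‖ ≤ L * ‖x - y‖) {ρ : ℝ} (hρ : 0 ≤ ρ)
    {w y z z' : Vec n} (hw : ‖w‖ + 3 * ρ ≤ R) (hy : ‖y - w‖ ≤ ρ)
    (hz : ‖z - w‖ ≤ ρ) (hz' : ‖z' - w‖ ≤ ρ) :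
    ‖(partialIntegral K y z - partialIntegral K w z) -
      (partialIntegral K y z' - partialIntegral K w z')‖ ≤ n * (2 * L) * ρ * ‖z - z'‖ := by
  rw [partialIntegral_sub hK, partialIntegral_sub hK, ← Finset.sum_sub_distrib]
  have hterm : ∀ i ∈ (Finset.univ : Finset (Fin n)),
      ‖(∫ μ in (w i)..(y i), K (WithLp.toLp 2 (Function.update (WithLp.ofLp z) i μ)) (stdBasis i)) -
        ∫ μ in (w i)..(y i), K (WithLp.toLp 2 (Function.update (WithLp.ofLp z') i μ)) (stdBasis i)‖
        ≤ L * (2 * ‖z - z'‖) * ρ := by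
    intro i _
    have hc : ∀ z : Vec n, Continuous fun μ : ℝ =>
        K (WithLp.toLp 2 (Function.update (WithLp.ofLp z) i μ)) (stdBasis i) := fun z =>
      (hK.comp (continuous_toLp_update z i)).clm_apply continuous_const
    rw [← intervalIntegral.integral_sub ((hc z).intervalIntegrable _ _)
      ((hc z').intervalIntegrable _ _)]
    refine (intervalIntegral.norm_integral_le_of_norm_le_const (C := L * (2 * ‖z - z'‖))
      fun μ hμ => ?_).trans ?_
    · have hμ' := abs_sub_le_of_mem_uIoc hy (by simpa using hρ) hμ
      have hR : ∀ z : Vec n, ‖z - w‖ ≤ ρ →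
          ‖WithLp.toLp 2 (Function.update (WithLp.ofLp z) i μ)‖ ≤ R := by
        intro z hz
        have h3 := norm_toLp_update_sub_le hz hμ'
        have := norm_add_le
          (WithLp.toLp 2 (Function.update (WithLp.ofLp z) i μ) - w) w
        rw [sub_add_cancel] at this
        linarith
      rw [← sub_apply]
      refine ((K _ - K _).le_opNorm _).trans ?_
      rw [norm_stdBasis, mul_one]
      refine (hlip _ _ (hR z hz) (hR z' hz')).trans ?_
      gcongr
      exact norm_toLp_update_sub_toLp_update_le z z' i μ
    · have := (abs_apply_le_norm (y - w) i).trans hy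
      rw [PiLp.sub_apply] at this
      gcongr
  refine (norm_sum_le_of_le _ hterm).trans (le_of_eq ?_)
  simp
  ring

end PartialIntegral

/-! ### Linearization of the plant, uniform over bounded targets -/

section Linearization

variable {n m : ℕ} {f : Vec n → Vec n} {B : Vec n → (Vec m →L[ℝ] Vec n)}
  {K : Vec n → (Vec n →L[ℝ] Vec m)}

/-- Uniform linearization of the plant under the feedback `u + β(x, z) - β(w, z)` around
`x = z = w`, for `w` and `u` in bounded sets. -/
theorem exists_linearization_bound (hf : ContDiff ℝ 2 f) (hB : ContDiff ℝ 2 B)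
    (hK : ContDiff ℝ 1 K) (R U : ℝ) (hU : 0 ≤ U) :
    ∃ C, 0 ≤ C ∧ ∀ w u, ‖w‖ ≤ R → ‖u‖ ≤ U →
      ‖f w + B w u‖ ≤ C ∧
      (∀ v, ‖fderiv ℝ f w v + fderiv ℝ B w v u + B w (K w v)‖ ≤ C * ‖v‖) ∧
      ∀ ρ x y z z', 0 ≤ ρ → ρ ≤ 1 → ‖x - w‖ ≤ ρ → ‖y - w‖ ≤ ρ → ‖z - w‖ ≤ ρ → ‖z' - w‖ ≤ ρ →
        ‖(f x + B x (u + partialIntegral K x z - partialIntegral K w z)) -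
          (f y + B y (u + partialIntegral K y z' - partialIntegral K w z')) -
          (fderiv ℝ f w (x - y) + fderiv ℝ B w (x - y) u + B w (K w (x - y)))‖ ≤
        C * ρ * (‖x - y‖ + ‖z - z'‖) := by
  -- The margin `3` covers the points at distance `3ρ ≤ 3` where `β` evaluates `K`.
  obtain ⟨C₁, hC₁, hC₁'⟩ := exists_norm_sub_sub_fderiv_le hf (R + 3)
  obtain ⟨C₂, hC₂, hC₂'⟩ := exists_norm_sub_sub_fderiv_le hB (R + 3)
  obtain ⟨b₀, hb₀, hb₀'⟩ := exists_norm_le_of_continuous hB.continuous (R + 3)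
  obtain ⟨b₁, hb₁, hb₁'⟩ := exists_norm_sub_le_of_contDiff (hB.of_le one_le_two) (R + 3)
  obtain ⟨k₀, hk₀, hk₀'⟩ := exists_norm_le_of_continuous hK.continuous (R + 3)
  obtain ⟨k₁, hk₁, hk₁'⟩ := exists_norm_sub_le_of_contDiff hK (R + 3)
  obtain ⟨f₀, hf₀, hf₀'⟩ := exists_norm_le_of_continuous hf.continuous (R + 3)
  obtain ⟨f₁, hf₁, hf₁'⟩ := exists_norm_le_of_continuous (hf.continuous_fderiv two_ne_zero) (R + 3)
  obtain ⟨b₂, hb₂, hb₂'⟩ := exists_norm_le_of_continuous (hB.continuous_fderiv two_ne_zero) (R + 3)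
  set c : ℝ := n * (3 * k₁) with hc
  have hc0 : 0 ≤ c := by positivity
  refine ⟨(f₀ + b₀ * U) + (f₁ + b₂ * U + b₀ * k₀) +
    (C₁ + C₂ * U + b₁ * (c + k₀) + b₁ * (c + k₀) + b₀ * c), by positivity, ?_⟩
  intro w u hw hu
  have hw3 : ‖w‖ ≤ R + 3 := by linarith
  have hBw := hb₀' w hw3
  have hKw := hk₀' w hw3
  refine ⟨?_, fun v => ?_, ?_⟩
  · have h1 : ‖f w + B w u‖ ≤ f₀ + b₀ * U :=
      (norm_add_le _ _).trans (add_le_add (hf₀' w hw3) ((B w).le_of_opNorm_le_of_le hBw hu))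
    refine h1.trans ?_
    have : 0 ≤ (f₁ + b₂ * U + b₀ * k₀) +
      (C₁ + C₂ * U + b₁ * (c + k₀) + b₁ * (c + k₀) + b₀ * c) := by positivity
    linarith
  · have h1 : ‖fderiv ℝ f w v‖ ≤ f₁ * ‖v‖ := (fderiv ℝ f w).le_of_opNorm_le (hf₁' w hw3) v
    have h2 : ‖fderiv ℝ B w v u‖ ≤ b₂ * ‖v‖ * U :=
      ContinuousLinearMap.le_of_opNorm_le_of_le _
        ((fderiv ℝ B w).le_of_opNorm_le (hb₂' w hw3) v) hu
    have h3 : ‖B w (K w v)‖ ≤ b₀ * (k₀ * ‖v‖) :=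
      (B w).le_of_opNorm_le_of_le hBw ((K w).le_of_opNorm_le hKw v)
    have h4 : ‖fderiv ℝ f w v + fderiv ℝ B w v u + B w (K w v)‖ ≤
        (f₁ + b₂ * U + b₀ * k₀) * ‖v‖ := by
      refine norm_add₃_le.trans ?_
      linarith
    refine h4.trans (mul_le_mul_of_nonneg_right ?_ (norm_nonneg v))
    have : 0 ≤ (f₀ + b₀ * U) +
      (C₁ + C₂ * U + b₁ * (c + k₀) + b₁ * (c + k₀) + b₀ * c) := by positivity
    linarith
  · intro ρ x y z z' hρ hρ1 hx hy hz hz'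
    have hwρ : ‖w‖ + ρ ≤ R + 3 := by linarith
    have hwρ3 : ‖w‖ + 3 * ρ ≤ R + 3 := by linarith
    have hball : ∀ v : Vec n, ‖v - w‖ ≤ ρ → ‖v‖ ≤ R + 3 := fun v hv => by
      have := norm_add_le (v - w) w
      rw [sub_add_cancel] at this
      linarith
    set a := ‖x - y‖ with ha
    set b := ‖z - z'‖ with hb
    have ha0 : 0 ≤ a := norm_nonneg _
    have hb0 : 0 ≤ b := norm_nonneg _
    set p := partialIntegral K x z - partialIntegral K w z with hp
    set p' := partialIntegral K y z' - partialIntegral K w z' with hp'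
    have hA := norm_partialIntegral_sub_sub_le hK.continuous hk₁ hk₁' hρ hwρ3 hx hy hz
    have hA' := norm_partialIntegral_sub_sub_le hK.continuous hk₁ hk₁' hρ hwρ3 hx
      (by simpa using hρ : ‖w - w‖ ≤ ρ) hz
    have hA'' := norm_partialIntegral_sub_sub_sub_le hK.continuous hk₁ hk₁' hρ hwρ3 hy hz hz'
    -- First `x` moves to `y` with `z` fixed, then `z` moves to `z'`.
    have hpp : ‖p - p' - K w (x - y)‖ ≤ c * ρ * (a + b) := by
      have heq : p - p' - K w (x - y) =
          (partialIntegral K x z - partialIntegral K y z - K w (x - y)) +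
          ((partialIntegral K y z - partialIntegral K w z) -
            (partialIntegral K y z' - partialIntegral K w z')) := by
        rw [hp, hp']; abel
      rw [heq]
      refine (norm_add_le _ _).trans ((add_le_add hA hA'').trans ?_)
      have : 0 ≤ n * k₁ * ρ * b := by positivity
      rw [hc]
      linarith
    have hKxw : ∀ v, ‖K w v‖ ≤ k₀ * ‖v‖ := fun v => (K w).le_of_opNorm_le hKw v
    have hpn : ‖p‖ ≤ (c + k₀) * ρ := by
      have h1 := norm_add_le (p - K w (x - w)) (K w (x - w))
      rw [sub_add_cancel] at h1
      have h2 : c * ρ * ‖x - w‖ ≤ c * ρ * 1 := by gcongr; linarith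
      have h3 : k₀ * ‖x - w‖ ≤ k₀ * ρ := by gcongr
      linarith [hKxw (x - w)]
    have hppn : ‖p - p'‖ ≤ (c + k₀) * (a + b) := by
      have h1 := norm_add_le (p - p' - K w (x - y)) (K w (x - y))
      rw [sub_add_cancel] at h1
      have h2 : c * ρ * (a + b) ≤ c * 1 * (a + b) := by gcongr
      have h3 : 0 ≤ k₀ * b := by positivity
      linarith [hKxw (x - y)]
    -- Each of the five summands carries a factor `ρ`: from a first-order remainder, from `‖p‖`, or
    -- from `‖y - w‖`.
    have heq : (f x + B x (u + partialIntegral K x z - partialIntegral K w z)) -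
        (f y + B y (u + partialIntegral K y z' - partialIntegral K w z')) -
        (fderiv ℝ f w (x - y) + fderiv ℝ B w (x - y) u + B w (K w (x - y))) =
        (f x - f y - fderiv ℝ f w (x - y)) + (B x - B y - fderiv ℝ B w (x - y)) u +
        (B x - B y) p + (B y - B w) (p - p') + B w (p - p' - K w (x - y)) := by
      rw [hp, hp']
      simp only [map_sub, map_add, sub_apply]
      abel
    have t1 := hC₁' ρ w x y hρ hwρ hx hy
    have t2 : ‖(B x - B y - fderiv ℝ B w (x - y)) u‖ ≤ C₂ * ρ * a * U :=
      ContinuousLinearMap.le_of_opNorm_le_of_le _ (hC₂' ρ w x y hρ hwρ hx hy) hu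
    have t3 : ‖(B x - B y) p‖ ≤ b₁ * a * ((c + k₀) * ρ) :=
      ContinuousLinearMap.le_of_opNorm_le_of_le _ (hb₁' x y (hball x hx) (hball y hy)) hpn
    have t4 : ‖(B y - B w) (p - p')‖ ≤ b₁ * ρ * ((c + k₀) * (a + b)) :=
      ContinuousLinearMap.le_of_opNorm_le_of_le _
        ((hb₁' y w (hball y hy) hw3).trans (by gcongr)) hppn
    have t5 : ‖B w (p - p' - K w (x - y))‖ ≤ b₀ * (c * ρ * (a + b)) :=
      ContinuousLinearMap.le_of_opNorm_le_of_le _ hBw hpp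
    rw [heq]
    refine (norm_add_le_of_le (norm_add_le_of_le (norm_add_le_of_le (norm_add_le_of_le t1 t2) t3)
      t4) t5).trans ?_
    have s1 : 0 ≤ ((f₀ + b₀ * U) + (f₁ + b₂ * U + b₀ * k₀)) * ρ * (a + b) := by positivity
    have s2 : 0 ≤ (C₁ + C₂ * U + b₁ * (c + k₀)) * ρ * b := by positivity
    linarith

end Linearization

/-! ### Smoothness of the gain -/

section Smooth

variable {n m : ℕ} {B : Vec n → (Vec m →L[ℝ] Vec n)} {M : Vec n → (Vec n →L[ℝ] Vec n)}
  {γ : Vec n → ℝ}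

theorem contDiff_adjoint {k : WithTop ℕ∞} : ContDiff ℝ k
    (fun A : Vec m →L[ℝ] Vec n => ContinuousLinearMap.adjoint A) := by
  have : IsBoundedLinearMap ℝ (fun A : Vec m →L[ℝ] Vec n => ContinuousLinearMap.adjoint A) :=
    { map_add := fun A A' => map_add _ A A'
      map_smul := fun c A => by simp
      bound := ⟨1, one_pos, fun A => by simp⟩ }
  exact this.contDiff

theorem contDiff_gain {k : WithTop ℕ∞} (hB : ContDiff ℝ k B) (hM : ContDiff ℝ k M)
    (hγ : ContDiff ℝ k γ)
    (hinj : ∀ x, Function.Injective ((M x) ∘L (B x))) (γ₀ : ℝ) :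
    ContDiff ℝ k (gain B M γ γ₀) := by
  have hN : ContDiff ℝ k fun x => (M x) ∘L (B x) := hM.clm_comp hB
  have hN' : ContDiff ℝ k fun x => ContinuousLinearMap.adjoint ((M x) ∘L (B x)) :=
    contDiff_adjoint.comp hN
  have hR : ContDiff ℝ k (damping B M) := by
    rw [contDiff_iff_contDiffAt]
    intro x
    obtain ⟨e, he⟩ := isInvertible_adjoint_comp_self (hinj x)
    refine ContDiffAt.comp (g := ContinuousLinearMap.inverse) x ?_ (hN'.clm_comp hN).contDiffAt
    rw [← he]
    exact contDiffAt_map_inverse e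
  exact (hγ.add contDiff_const).neg.smul (hR.clm_comp hN')

end Smooth

end CCM

namespace CCM

/-! ### Estimates in a tube of small radius -/

section Tube

variable {n m : ℕ} {f : Vec n → Vec n} {B : Vec n → (Vec m →L[ℝ] Vec n)}
  {M : Vec n → (Vec n →L[ℝ] Vec n)} {K : Vec n → (Vec n →L[ℝ] Vec m)}

/-- Data for the behaviour of the closed loop in the tube of radius `ρ` around a curve in the ball
of radius `R`, driven by inputs of size at most `U`. -/
structure IsTubeBound (f : Vec n → Vec n) (B : Vec n → (Vec m →L[ℝ] Vec n))
    (M : Vec n → (Vec n →L[ℝ] Vec n)) (K : Vec n → (Vec n →L[ℝ] Vec m))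
    (R U μ η ρ L : ℝ) : Prop where
  bound : ∀ w u, ‖w‖ ≤ R → ‖u‖ ≤ U → ‖f w + B w u‖ ≤ L
  lipschitz : ∀ w u, ‖w‖ ≤ R → ‖u‖ ≤ U → ∀ x y z z', ‖x - w‖ ≤ ρ → ‖y - w‖ ≤ ρ → ‖z - w‖ ≤ ρ →
    ‖z' - w‖ ≤ ρ → ‖(f x + B x (u + partialIntegral K x z - partialIntegral K w z)) -
      (f y + B y (u + partialIntegral K y z' - partialIntegral K w z'))‖ ≤
        L * (‖x - y‖ + ‖z - z'‖)
  contracting : ∀ w u, ‖w‖ ≤ R → ‖u‖ ≤ U → ∀ x y z z', ‖x - w‖ ≤ ρ → ‖y - w‖ ≤ ρ →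
    ‖z - w‖ ≤ ρ → ‖z' - w‖ ≤ ρ → ⟪x - y, fderiv ℝ M w (f w + B w u) (x - y)⟫_ℝ +
      2 * ⟪x - y, M w ((f x + B x (u + partialIntegral K x z - partialIntegral K w z)) -
        (f y + B y (u + partialIntegral K y z' - partialIntegral K w z')))⟫_ℝ ≤
      -μ * ‖x - y‖ ^ 2 + η * ‖x - y‖ * (‖x - y‖ + ‖z - z'‖)

theorem exists_isTubeBound (hf : ContDiff ℝ 2 f) (hB : ContDiff ℝ 2 B) (hK : ContDiff ℝ 1 K)
    (hM : Continuous M) {μ : ℝ}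
    (hlin : ∀ x v u, ⟪v, fderiv ℝ M x (f x + B x u) v⟫_ℝ +
      2 * ⟪v, M x (fderiv ℝ f x v + fderiv ℝ B x v u + B x (K x v))⟫_ℝ ≤ -μ * ‖v‖ ^ 2)
    (R : ℝ) {U : ℝ} (hU : 0 ≤ U) {η : ℝ} (hη : 0 < η) :
    ∃ ρ L, 0 < ρ ∧ 0 ≤ L ∧ IsTubeBound f B M K R U μ η ρ L := by
  obtain ⟨C, hC, h⟩ := exists_linearization_bound hf hB hK R U hU
  obtain ⟨b, hb, hb'⟩ := exists_norm_le_of_continuous hM R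
  -- The error enters the Lyapunov derivative as `2bCρ`, which the radius has to make at most `η`;
  -- the `+ 1` avoids division by zero.
  have hden : 0 < 2 * b * C + 1 := by positivity
  have hρ0 : 0 < min 1 (η / (2 * b * C + 1)) := by positivity
  set ρ := min 1 (η / (2 * b * C + 1)) with hρdef
  have hρ1 : ρ ≤ 1 := min_le_left _ _
  have hρη : 2 * b * C * ρ ≤ η := by
    have := (le_div_iff₀ hden).1 (min_le_right 1 (η / (2 * b * C + 1)))
    rw [← hρdef] at this
    linarith
  refine ⟨ρ, 2 * C, hρ0, by positivity, fun w u hw hu => ?_, fun w u hw hu x y z z' hx hy hz hz' => ?_,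
    fun w u hw hu x y z z' hx hy hz hz' => ?_⟩
  · linarith [(h w u hw hu).1]
  · obtain ⟨-, h2, h3⟩ := h w u hw hu
    have h4 := h3 ρ x y z z' hρ0.le hρ1 hx hy hz hz'
    have h5 := h2 (x - y)
    have h6 : C * ρ * (‖x - y‖ + ‖z - z'‖) ≤ C * 1 * (‖x - y‖ + ‖z - z'‖) := by gcongr
    have h7 : 0 ≤ C * ‖z - z'‖ := by positivity
    have h8 := norm_add_le_of_le h4 h5
    rw [sub_add_cancel] at h8
    linarith
  · obtain ⟨-, -, h3⟩ := h w u hw hu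
    have h4 := h3 ρ x y z z' hρ0.le hρ1 hx hy hz hz'
    have h5 := hlin w (x - y) u
    generalize (f x + B x (u + partialIntegral K x z - partialIntegral K w z)) -
        (f y + B y (u + partialIntegral K y z' - partialIntegral K w z')) = g at *
    generalize fderiv ℝ f w (x - y) + fderiv ℝ B w (x - y) u + B w (K w (x - y)) = A at *
    have h6 : ⟪x - y, M w g⟫_ℝ = ⟪x - y, M w A⟫_ℝ + ⟪x - y, M w (g - A)⟫_ℝ := by
      rw [← inner_add_right, ← map_add]
      congr 2
      abel
    have h7 : ⟪x - y, M w (g - A)⟫_ℝ ≤ ‖x - y‖ * (b * (C * ρ * (‖x - y‖ + ‖z - z'‖))) :=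
      (real_inner_le_norm _ _).trans (mul_le_mul_of_nonneg_left
        ((M w).le_of_opNorm_le_of_le (hb' w hw) h4) (norm_nonneg _))
    have h8 : 2 * b * C * ρ * (‖x - y‖ * (‖x - y‖ + ‖z - z'‖)) ≤
        η * (‖x - y‖ * (‖x - y‖ + ‖z - z'‖)) := by gcongr
    rw [h6]
    linarith

end Tube

/-! ### Lyapunov functions for the plant and the closed loop -/

section ClosedLoop

variable {n m : ℕ} {f : Vec n → Vec n} {B : Vec n → (Vec m →L[ℝ] Vec n)}
  {M : Vec n → (Vec n →L[ℝ] Vec n)} {K : Vec n → (Vec n →L[ℝ] Vec m)}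
  {plow pup lam R U μ η ρ L l : ℝ} {xd : ℝ → Vec n} {ud : ℝ → Vec m}

theorem feedback_target (t : ℝ) (z : Vec n) : feedback K xd ud t (xd t) z = ud t := by
  simp [feedback]

theorem isSolution_closedLoop_target (hxd : IsSolution (plant f B (fun _ t => ud t)) xd) :
    IsSolution (closedLoop f B K xd ud l) (fun t => (xd t, xd t)) := by
  intro t ht
  have heq : closedLoop f B K xd ud l t (xd t, xd t) =
      (plant f B (fun _ t => ud t) t (xd t), plant f B (fun _ t => ud t) t (xd t)) := by
    simp only [closedLoop, plant, feedback_target, sub_self, smul_zero, sub_zero]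
  rw [heq]
  exact (hxd t ht).prodMk (hxd t ht)

theorem isSolution_plant_target (hxd : IsSolution (plant f B (fun _ t => ud t)) xd)
    (z : ℝ → Vec n) : IsSolution (plant f B (fun x t => feedback K xd ud t x (z t))) xd := by
  intro t ht
  have heq : plant f B (fun x t => feedback K xd ud t x (z t)) t (xd t) =
      plant f B (fun _ t => ud t) t (xd t) := by
    simp only [plant, feedback_target]
  rw [heq]
  exact hxd t ht

theorem continuousOn_feedback (hK : Continuous K) {Y : Type*} [TopologicalSpace Y] {s : Set Y}
    {τ : Y → ℝ} {x z : Y → Vec n} (hxd : ContinuousOn xd (Ici 0)) (hud : ContinuousOn ud (Ici 0))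
    (hτ : ContinuousOn τ s) (hτ' : MapsTo τ s (Ici 0)) (hx : ContinuousOn x s)
    (hz : ContinuousOn z s) : ContinuousOn (fun q => feedback K xd ud (τ q) (x q) (z q)) s := by
  have hβ : ∀ {x : Y → Vec n}, ContinuousOn x s →
      ContinuousOn (fun q => partialIntegral K (x q) (z q)) s := fun {x} hx =>
    (continuous_partialIntegral hK).comp_continuousOn (f := fun q => (x q, z q)) (hx.prodMk hz)
  have hxd' : ContinuousOn (fun q => xd (τ q)) s := hxd.comp hτ hτ'
  have hud' : ContinuousOn (fun q => ud (τ q)) s := hud.comp hτ hτ'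
  simp only [feedback]
  exact (hud'.add (hβ hx)).sub (hβ hxd')

theorem hasDerivAt_inner_metric (hM : IsControlContractionMetric f B M plow pup lam)
    {xd a : ℝ → Vec n} {xd' a' : Vec n} {t : ℝ} (hxd : HasDerivAt xd xd' t)
    (ha : HasDerivAt a a' t) :
    HasDerivAt (fun s => ⟪a s, M (xd s) (a s)⟫_ℝ)
      (⟪a t, fderiv ℝ M (xd t) xd' (a t)⟫_ℝ + 2 * ⟪a t, M (xd t) a'⟫_ℝ) t := by
  have h1 : HasDerivAt (fun s => M (xd s)) (fderiv ℝ M (xd t) xd') t :=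
    (hM.differentiable (xd t)).hasFDerivAt.comp_hasDerivAt t hxd
  have h2 := ha.inner ℝ (h1.clm_apply ha)
  refine h2.congr_deriv ?_
  have h3 : ⟪a', M (xd t) (a t)⟫_ℝ = ⟪a t, M (xd t) a'⟫_ℝ := by
    rw [← hM.inner_apply_comm, real_inner_comm]
  rw [inner_add_right, h3]
  ring

theorem continuousOn_inner_metric (hM : IsControlContractionMetric f B M plow pup lam)
    (hxd : ContinuousOn xd (Ici 0)) {Y : Type*} [TopologicalSpace Y] {s : Set Y}
    {τ : Y → ℝ} {a : Y → Vec n} (hτ : ContinuousOn τ s) (hτ' : MapsTo τ s (Ici 0))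
    (ha : ContinuousOn a s) : ContinuousOn (fun q => ⟪a q, M (xd (τ q)) (a q)⟫_ℝ) s :=
  ha.inner ((hM.smooth.continuous.comp_continuousOn (hxd.comp hτ hτ')).clm_apply ha)

/-- The metric along the target is a Lyapunov function for differences of solutions of the plant,
uniformly over all signals `z` close to the target. -/
theorem isIncrementalLyapunov_plant (hM : IsControlContractionMetric f B M plow pup lam)
    (h : IsTubeBound f B M K R U μ η ρ L) (hμ : 0 < μ) (hημ : 6 * η ≤ μ) (hpup : 0 < pup)
    (hxd : IsSolution (plant f B (fun _ t => ud t)) xd) (hR : ∀ t, 0 ≤ t → ‖xd t‖ ≤ R)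
    (hU : ∀ t, 0 ≤ t → ‖ud t‖ ≤ U) {z : ℝ → Vec n} (hz : ∀ t, 0 ≤ t → ‖z t - xd t‖ ≤ ρ) :
    IsIncrementalLyapunov (plant f B (fun x t => feedback K xd ud t x (z t))) xd ρ plow pup
      (μ / (4 * pup)) (fun t e => ⟪e, M (xd t) e⟫_ℝ) := by
  refine ⟨fun t _ e => hM.lower _ _, fun t _ e => hM.upper _ _, ?_, ?_⟩
  · exact continuousOn_inner_metric hM hxd.continuousOn continuousOn_fst (fun q hq => hq.1)
      continuousOn_snd
  · intro t ht x₁ x₂ h₁ h₂ hd₁ hd₂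
    refine ⟨_, hasDerivAt_inner_metric hM (hxd.hasDerivAt ht) (hd₁.sub hd₂), ?_⟩
    have hc := h.contracting (xd t) (ud t) (hR t ht.le) (hU t ht.le) (x₁ t) (x₂ t) (z t) (z t)
      (mem_ball_iff_norm.1 h₁).le (mem_ball_iff_norm.1 h₂).le (hz t ht.le) (hz t ht.le)
    have hu := hM.upper (xd t) (x₁ t - x₂ t)
    have hu' : -(μ / 2) * ‖x₁ t - x₂ t‖ ^ 2 ≤
        -(2 * (μ / (4 * pup))) * ⟪x₁ t - x₂ t, M (xd t) (x₁ t - x₂ t)⟫_ℝ := by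
      have := mul_le_mul_of_nonneg_left hu (by positivity : 0 ≤ 2 * (μ / (4 * pup)))
      have h2 : 2 * (μ / (4 * pup)) * (pup * ‖x₁ t - x₂ t‖ ^ 2) =
          μ / 2 * ‖x₁ t - x₂ t‖ ^ 2 := by field_simp; ring
      linarith
    refine le_trans ?_ hu'
    refine le_trans hc ?_
    rw [sub_self (z t), norm_zero]
    nlinarith [sq_nonneg ‖x₁ t - x₂ t‖]

/-- The input cancels in `ż - ẋ`, so `‖e₂ - e₁‖²` decays at rate exactly `2ℓ`. The metric term
decays up to `η‖e₁‖(‖e₁‖ + ‖e₂‖)`, which half of each decay absorbs. -/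
theorem isIncrementalLyapunov_closedLoop (hM : IsControlContractionMetric f B M plow pup lam)
    (h : IsTubeBound f B M K R U μ η ρ L) (hμ : 0 < μ) (hη : 0 ≤ η) (hημ : 6 * η ≤ μ) (hηl : η ≤ l)
    (hpup : 0 < pup)
    (hxd : IsSolution (plant f B (fun _ t => ud t)) xd) (hR : ∀ t, 0 ≤ t → ‖xd t‖ ≤ R)
    (hU : ∀ t, 0 ≤ t → ‖ud t‖ ≤ U) :
    IsIncrementalLyapunov (closedLoop f B K xd ud l) (fun t => (xd t, xd t)) ρ
      (min plow 1 / 2) (pup + 4) (min (μ / (4 * pup)) (l / 2))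
      (fun t e => ⟪e.1, M (xd t) e.1⟫_ℝ + ‖e.2 - e.1‖ ^ 2) := by
  refine ⟨fun t _ e => ?_, fun t _ e => ?_, ?_, ?_⟩
  · have h1 := hM.lower (xd t) e.1
    have h2 : ‖e.2‖ ^ 2 ≤ 2 * (‖e.1‖ ^ 2 + ‖e.2 - e.1‖ ^ 2) := by
      have := norm_add_le (e.2 - e.1) e.1
      rw [sub_add_cancel] at this
      nlinarith [sq_nonneg (‖e.1‖ - ‖e.2 - e.1‖), norm_nonneg e.2]
    have h3 : ‖e‖ ^ 2 ≤ 2 * (‖e.1‖ ^ 2 + ‖e.2 - e.1‖ ^ 2) := by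
      rcases max_choice ‖e.1‖ ‖e.2‖ with hm | hm <;> rw [Prod.norm_def, hm]
      · nlinarith [sq_nonneg ‖e.1‖, sq_nonneg ‖e.2 - e.1‖]
      · exact h2
    have hmin : 0 < min plow 1 := lt_min hM.plow_pos one_pos
    calc min plow 1 / 2 * ‖e‖ ^ 2 ≤ min plow 1 / 2 * (2 * (‖e.1‖ ^ 2 + ‖e.2 - e.1‖ ^ 2)) := by
          gcongr
      _ = min plow 1 * ‖e.1‖ ^ 2 + min plow 1 * ‖e.2 - e.1‖ ^ 2 := by ring
      _ ≤ plow * ‖e.1‖ ^ 2 + 1 * ‖e.2 - e.1‖ ^ 2 := by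
          gcongr
          · exact min_le_left _ _
          · exact min_le_right _ _
      _ ≤ _ := by linarith
  · have h1 := hM.upper (xd t) e.1
    have h2 : ‖e.2 - e.1‖ ≤ 2 * ‖e‖ := by
      linarith [norm_sub_le e.2 e.1, norm_fst_le e, norm_snd_le e]
    have h3 : ‖e.2 - e.1‖ ^ 2 ≤ (2 * ‖e‖) ^ 2 := by gcongr
    have h4 : pup * ‖e.1‖ ^ 2 ≤ pup * ‖e‖ ^ 2 := by
      gcongr
      exact norm_fst_le e
    linarith
  · exact (continuousOn_inner_metric hM hxd.continuousOn continuousOn_fst (fun q hq => hq.1)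
      continuousOn_snd.fst).add (by fun_prop)
  · intro t ht x₁ x₂ h₁ h₂ hd₁ hd₂
    have hfst : HasDerivAt (fun s => (x₁ s - x₂ s).1)
        (closedLoop f B K xd ud l t (x₁ t) - closedLoop f B K xd ud l t (x₂ t)).1 t :=
      (ContinuousLinearMap.fst ℝ (Vec n) (Vec n)).hasFDerivAt.comp_hasDerivAt t (hd₁.sub hd₂)
    have hsnd : HasDerivAt (fun s => (x₁ s - x₂ s).2)
        (closedLoop f B K xd ud l t (x₁ t) - closedLoop f B K xd ud l t (x₂ t)).2 t :=
      (ContinuousLinearMap.snd ℝ (Vec n) (Vec n)).hasFDerivAt.comp_hasDerivAt t (hd₁.sub hd₂)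
    have hdiff : HasDerivAt (fun s => (x₁ s - x₂ s).2 - (x₁ s - x₂ s).1)
        ((closedLoop f B K xd ud l t (x₁ t) - closedLoop f B K xd ud l t (x₂ t)).2 -
          (closedLoop f B K xd ud l t (x₁ t) - closedLoop f B K xd ud l t (x₂ t)).1) t :=
      hsnd.sub hfst
    refine ⟨_, (hasDerivAt_inner_metric hM (hxd.hasDerivAt ht) hfst).add
      hdiff.norm_sq, ?_⟩
    rw [mem_ball_iff_norm] at h₁ h₂
    have hc := h.contracting (xd t) (ud t) (hR t ht.le) (hU t ht.le) (x₁ t).1 (x₂ t).1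
      (x₁ t).2 (x₂ t).2 ((norm_fst_le _).trans h₁.le) ((norm_fst_le _).trans h₂.le)
      ((norm_snd_le _).trans h₁.le) ((norm_snd_le _).trans h₂.le)
    have hd : (closedLoop f B K xd ud l t (x₁ t) - closedLoop f B K xd ud l t (x₂ t)).2 -
        (closedLoop f B K xd ud l t (x₁ t) - closedLoop f B K xd ud l t (x₂ t)).1 =
        -(l • ((x₁ t - x₂ t).2 - (x₁ t - x₂ t).1)) := by
      simp only [closedLoop, Prod.snd_sub, Prod.fst_sub, smul_sub]
      abel
    have hu := hM.upper (xd t) (x₁ t - x₂ t).1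
    have hlow := (mul_nonneg hM.plow_pos.le (sq_nonneg _)).trans (hM.lower (xd t) (x₁ t - x₂ t).1)
    have hκ₁ := min_le_left (μ / (4 * pup)) (l / 2)
    have hκ₂ := min_le_right (μ / (4 * pup)) (l / 2)
    set κ := min (μ / (4 * pup)) (l / 2)
    have hu' : 2 * κ * ⟪(x₁ t - x₂ t).1, M (xd t) (x₁ t - x₂ t).1⟫_ℝ ≤
        μ / 2 * ‖(x₁ t - x₂ t).1‖ ^ 2 := by
      calc _ ≤ 2 * (μ / (4 * pup)) * (pup * ‖(x₁ t - x₂ t).1‖ ^ 2) := by gcongr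
        _ = _ := by field_simp; ring
    have hb := norm_add_le ((x₁ t - x₂ t).2 - (x₁ t - x₂ t).1) (x₁ t - x₂ t).1
    rw [sub_add_cancel] at hb
    rw [hd, inner_neg_right, real_inner_smul_right, real_inner_self_eq_norm_sq]
    change ⟪(x₁ t - x₂ t).1, fderiv ℝ M (xd t) (f (xd t) + B (xd t) (ud t)) (x₁ t - x₂ t).1⟫_ℝ +
      2 * ⟪(x₁ t - x₂ t).1, M (xd t) (closedLoop f B K xd ud l t (x₁ t) -
        closedLoop f B K xd ud l t (x₂ t)).1⟫_ℝ ≤ -μ * ‖(x₁ t - x₂ t).1‖ ^ 2 +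
      η * ‖(x₁ t - x₂ t).1‖ * (‖(x₁ t - x₂ t).1‖ + ‖(x₁ t - x₂ t).2‖) at hc
    change ⟪(x₁ t - x₂ t).1, fderiv ℝ M (xd t) (f (xd t) + B (xd t) (ud t)) (x₁ t - x₂ t).1⟫_ℝ +
      2 * ⟪(x₁ t - x₂ t).1, M (xd t) (closedLoop f B K xd ud l t (x₁ t) -
        closedLoop f B K xd ud l t (x₂ t)).1⟫_ℝ + _ ≤ _
    set α := ‖(x₁ t - x₂ t).1‖
    set δ := ‖(x₁ t - x₂ t).2 - (x₁ t - x₂ t).1‖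
    have hα : 0 ≤ α := norm_nonneg _
    -- Uses `‖e₂‖ ≤ α + δ`. With `6η ≤ μ` and `η ≤ l` there remains `-(μ/2)α² - lδ²`, which the
    -- choice of `κ` turns into `-2κW`.
    have h1 : η * α * (α + ‖(x₁ t - x₂ t).2‖) ≤ η * (3 * α ^ 2 + δ ^ 2) := by
      rw [mul_assoc]
      refine mul_le_mul_of_nonneg_left ?_ hη
      nlinarith [sq_nonneg (α - δ), sq_nonneg α, sq_nonneg δ]
    have h2 : 6 * η * α ^ 2 ≤ μ * α ^ 2 := by gcongr
    have h3 : η * δ ^ 2 ≤ l * δ ^ 2 := by gcongr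
    have h4 : 2 * κ * δ ^ 2 ≤ 2 * (l / 2) * δ ^ 2 := by gcongr
    linarith

end ClosedLoop

end CCM

namespace CCM

/-! ### Contraction of the two systems -/

section Contraction

variable {n m : ℕ} {f : Vec n → Vec n} {B : Vec n → (Vec m →L[ℝ] Vec n)}
  {M : Vec n → (Vec n →L[ℝ] Vec n)} {K : Vec n → (Vec n →L[ℝ] Vec m)}
  {plow pup lam R U μ η ρ L l : ℝ} {xd : ℝ → Vec n} {ud : ℝ → Vec m}

theorem isContractingFrom_plant (hM : IsControlContractionMetric f B M plow pup lam)
    (h : IsTubeBound f B M K R U μ η ρ L) (hμ : 0 < μ) (hημ : 6 * η ≤ μ) (hpup : 0 < pup)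
    (hρ : 0 < ρ) (hL : 0 ≤ L) (hf : Continuous f) (hB : Continuous B) (hK : Continuous K)
    (hud : ContinuousOn ud (Ici 0))
    (hxd : IsSolution (plant f B (fun _ t => ud t)) xd) (hR : ∀ t, 0 ≤ t → ‖xd t‖ ≤ R)
    (hU : ∀ t, 0 ≤ t → ‖ud t‖ ≤ U) {z : ℝ → Vec n} (hzc : ContinuousOn z (Ici 0))
    (hz : ∀ t, 0 ≤ t → ‖z t - xd t‖ ≤ ρ) {S : Set (Vec n)}
    (hS : ∀ x ∈ S, pup * ‖x - xd 0‖ ^ 2 < plow * ρ ^ 2) :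
    IsContractingFrom (plant f B (fun x t => feedback K xd ud t x (z t))) S := by
  have hlip : ∀ t, 0 ≤ t → ∀ x ∈ Metric.closedBall (xd t) ρ, ∀ y ∈ Metric.closedBall (xd t) ρ,
      ‖plant f B (fun x t => feedback K xd ud t x (z t)) t x -
        plant f B (fun x t => feedback K xd ud t x (z t)) t y‖ ≤ L * ‖x - y‖ := by
    intro t ht x hx y hy
    have := h.lipschitz (xd t) (ud t) (hR t ht) (hU t ht) x y (z t) (z t)
      (mem_closedBall_iff_norm.1 hx) (mem_closedBall_iff_norm.1 hy) (hz t ht) (hz t ht)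
    rw [sub_self (z t), norm_zero, add_zero] at this
    exact this
  refine (isIncrementalLyapunov_plant hM h hμ hημ hpup hxd hR hU hz).isContractingFrom
    hM.plow_pos hpup.le hρ (by positivity) (isSolution_plant_target hxd z) ?_
    -- `L` bounds the field on the target itself; the Lipschitz estimate adds `Lρ` across the tube.
    (C := ⟨L * ρ + L, by positivity⟩) (L := ⟨L, hL⟩) ?_ ?_ hS
  · exact (hf.comp_continuousOn continuousOn_snd).add
      ((hB.comp_continuousOn continuousOn_snd).clm_apply
        (continuousOn_feedback hK hxd.continuousOn hud continuousOn_fst (fun q hq => hq.1)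
          continuousOn_snd (hzc.comp continuousOn_fst fun q hq => hq.1)))
  · intro t ht x hx
    have h1 := hlip t ht x hx (xd t) (Metric.mem_closedBall_self hρ.le)
    have h2 : ‖plant f B (fun x t => feedback K xd ud t x (z t)) t (xd t)‖ ≤ L := by
      simp only [plant, feedback_target]
      exact h.bound _ _ (hR t ht) (hU t ht)
    have h3 := norm_add_le_of_le h1 h2
    rw [sub_add_cancel] at h3
    refine h3.trans ?_
    have h4 := mul_le_mul_of_nonneg_left (mem_closedBall_iff_norm.1 hx) hL
    exact add_le_add_left h4 L
  · intro t ht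
    refine LipschitzOnWith.of_dist_le_mul fun x hx y hy => ?_
    rw [dist_eq_norm, dist_eq_norm]
    exact hlip t ht x hx y hy

theorem isContractingFrom_closedLoop (hM : IsControlContractionMetric f B M plow pup lam)
    (h : IsTubeBound f B M K R U μ η ρ L) (hμ : 0 < μ) (hη : 0 ≤ η) (hημ : 6 * η ≤ μ)
    (hηl : η ≤ l) (hl : 0 < l) (hpup : 0 < pup)
    (hρ : 0 < ρ) (hL : 0 ≤ L) (hf : Continuous f) (hB : Continuous B) (hK : Continuous K)
    (hud : ContinuousOn ud (Ici 0))
    (hxd : IsSolution (plant f B (fun _ t => ud t)) xd) (hR : ∀ t, 0 ≤ t → ‖xd t‖ ≤ R)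
    (hU : ∀ t, 0 ≤ t → ‖ud t‖ ≤ U) {S : Set (Vec n × Vec n)}
    (hS : ∀ p ∈ S, (pup + 4) * ‖p - (xd 0, xd 0)‖ ^ 2 < min plow 1 / 2 * ρ ^ 2) :
    IsContractingFrom (closedLoop f B K xd ud l) S := by
  have hplow := hM.plow_pos
  have hlip : ∀ t, 0 ≤ t → ∀ p ∈ Metric.closedBall (xd t, xd t) ρ,
      ∀ q ∈ Metric.closedBall (xd t, xd t) ρ,
      ‖closedLoop f B K xd ud l t p - closedLoop f B K xd ud l t q‖ ≤
        (2 * L + 2 * l) * ‖p - q‖ := by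
    intro t ht p hp q hq
    rw [mem_closedBall_iff_norm] at hp hq
    have h1 := h.lipschitz (xd t) (ud t) (hR t ht) (hU t ht) p.1 q.1 p.2 q.2
      ((norm_fst_le _).trans hp) ((norm_fst_le _).trans hq)
      ((norm_snd_le _).trans hp) ((norm_snd_le _).trans hq)
    have hfst : ‖p.1 - q.1‖ ≤ ‖p - q‖ := norm_fst_le (p - q)
    have hsnd : ‖p.2 - q.2‖ ≤ ‖p - q‖ := norm_snd_le (p - q)
    have h2 : ‖(closedLoop f B K xd ud l t p - closedLoop f B K xd ud l t q).1‖ ≤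
        2 * L * ‖p - q‖ := by
      refine h1.trans ?_
      have := mul_le_mul_of_nonneg_left (add_le_add hfst hsnd) hL
      linarith
    have h3 : ‖l • ((p.2 - q.2) - (p.1 - q.1))‖ ≤ 2 * l * ‖p - q‖ := by
      rw [norm_smul, Real.norm_of_nonneg hl.le]
      have := mul_le_mul_of_nonneg_left
        ((norm_sub_le (p.2 - q.2) (p.1 - q.1)).trans (add_le_add hsnd hfst)) hl.le
      linarith
    have h4 : (closedLoop f B K xd ud l t p - closedLoop f B K xd ud l t q).2 =
        (closedLoop f B K xd ud l t p - closedLoop f B K xd ud l t q).1 -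
          l • ((p.2 - q.2) - (p.1 - q.1)) := by
      simp only [closedLoop, Prod.snd_sub, Prod.fst_sub, smul_sub]
      abel
    rw [Prod.norm_def]
    refine max_le (h2.trans ?_) ?_
    · gcongr
      linarith
    · rw [h4]
      refine (norm_sub_le_of_le h2 h3).trans ?_
      linarith
  refine (isIncrementalLyapunov_closedLoop hM h hμ hη hημ hηl hpup hxd hR hU).isContractingFrom
    (by positivity) (by positivity) hρ (by positivity) (isSolution_closedLoop_target hxd) ?_
    (C := ⟨(2 * L + 2 * l) * ρ + L, by positivity⟩) (L := ⟨2 * L + 2 * l, by positivity⟩) ?_ ?_ hS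
  · have hx : ContinuousOn (fun q : ℝ × (Vec n × Vec n) => q.2.1) (Ici 0 ×ˢ univ) := by fun_prop
    have hz : ContinuousOn (fun q : ℝ × (Vec n × Vec n) => q.2.2) (Ici 0 ×ˢ univ) := by fun_prop
    have hG := (hf.comp_continuousOn hx).add ((hB.comp_continuousOn hx).clm_apply
        (continuousOn_feedback hK hxd.continuousOn hud continuousOn_fst (fun q hq => hq.1) hx hz))
    exact hG.prodMk (hG.sub ((hz.sub hx).const_smul l))
  · intro t ht p hp
    have h1 := hlip t ht p hp (xd t, xd t) (Metric.mem_closedBall_self hρ.le)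
    have h2 : ‖closedLoop f B K xd ud l t (xd t, xd t)‖ ≤ L := by
      simp only [closedLoop, feedback_target, sub_self, smul_zero, sub_zero, Prod.norm_def, max_self]
      exact h.bound _ _ (hR t ht) (hU t ht)
    have h3 := norm_add_le_of_le h1 h2
    rw [sub_add_cancel] at h3
    refine h3.trans ?_
    have h4 := mul_le_mul_of_nonneg_left (mem_closedBall_iff_norm.1 hp)
      (by positivity : 0 ≤ 2 * L + 2 * l)
    exact add_le_add_left h4 L
  · intro t ht
    refine LipschitzOnWith.of_dist_le_mul fun x hx y hy => ?_
    rw [dist_eq_norm, dist_eq_norm]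
    exact hlip t ht x hx y hy

theorem exists_pos_forall_lt_mul_sq_lt {a c : ℝ} (ha : 0 < a) (hc : 0 < c) :
    ∃ ε, 0 < ε ∧ ∀ s, 0 ≤ s → s < ε → c * s ^ 2 < a := by
  refine ⟨Real.sqrt (a / c), Real.sqrt_pos.2 (by positivity), fun s hs hlt => ?_⟩
  rw [Real.lt_sqrt hs, lt_div_iff₀ hc] at hlt
  linarith

end Contraction

theorem IsContractingFrom.tendsto_norm_sub {X : Type*} [NormedAddCommGroup X] [NormedSpace ℝ X]
    {F : ℝ → X → X} {S : Set X} (h : IsContractingFrom F S) {x₁ x₂ : ℝ → X}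
    (h₁ : IsSolution F x₁) (h₂ : IsSolution F x₂) (hS₁ : x₁ 0 ∈ S) (hS₂ : x₂ 0 ∈ S) :
    Tendsto (fun t => ‖x₁ t - x₂ t‖) atTop (𝓝 0) := by
  obtain ⟨-, k₁, k₂, -, hk₂, hk⟩ := h
  have hexp : Tendsto (fun t => k₁ * Real.exp (-k₂ * t) * ‖x₁ 0 - x₂ 0‖) atTop (𝓝 0) := by
    have h3 : Tendsto (fun t : ℝ => Real.exp (-k₂ * t)) atTop (𝓝 0) := by
      refine Real.tendsto_exp_atBot.comp ?_
      exact tendsto_id.const_mul_atTop_of_neg (neg_neg_of_pos hk₂)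
    simpa using (h3.const_mul k₁).mul_const ‖x₁ 0 - x₂ 0‖
  refine squeeze_zero' (Eventually.of_forall fun t => norm_nonneg _) ?_ hexp
  filter_upwards [eventually_ge_atTop 0] with t ht using hk x₁ x₂ h₁ h₂ hS₁ hS₂ t ht

end CCM

/-! ### Choice of constants and conclusion -/

theorem proposition6 {n m : ℕ} (hmn : m < n)
    -- the control system
    (f : CCM.Vec n → CCM.Vec n) (hf : ContDiff ℝ ∞ f)
    (B : CCM.Vec n → (CCM.Vec m →L[ℝ] CCM.Vec n)) (hB : ContDiff ℝ ∞ B)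
    (hBrank : ∀ x, Function.Injective (B x))
    -- the control contraction metric
    (M : CCM.Vec n → (CCM.Vec n →L[ℝ] CCM.Vec n)) (plow pup lam : ℝ)
    (hM : CCM.IsControlContractionMetric f B M plow pup lam)
    -- the damping gains that define `K`
    (r : ℝ) (hr : 1 / (2 * lam) < r)
    (γ : CCM.Vec n → ℝ) (hγ : ContDiff ℝ ∞ γ)
    (hγbound : ∀ x, r / plow * ‖CCM.driftForm f M x‖ ^ 2 ≤ γ x)
    (γ₀ : ℝ) (hγ₀ : 0 < γ₀)
    -- the target trajectory
    (ud : ℝ → CCM.Vec m) (hud : ContDiffOn ℝ 1 ud (Ici 0))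
    (hudbdd : ∃ C : ℝ, ∀ t : ℝ, 0 ≤ t → ‖ud t‖ ≤ C)
    (xd : ℝ → CCM.Vec n) (hxd : CCM.IsSolution (CCM.plant f B (fun _ t => ud t)) xd)
    (hxdbdd : ∃ C : ℝ, ∀ t : ℝ, 0 ≤ t → ‖xd t‖ ≤ C)
    (l : ℝ) (hl : 0 < l) :
    ∃ εstar : ℝ, 0 < εstar ∧ ∀ ε : ℝ, 0 < ε → ε < εstar →
      -- the closed loop in `(x, z)` is contracting
      CCM.IsContractingFrom (CCM.closedLoop f B (CCM.gain B M γ γ₀) xd ud l)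
        (Metric.ball (xd 0) ε ×ˢ Metric.ball (xd 0) ε) ∧
      ∀ p : ℝ → CCM.Vec n × CCM.Vec n,
        CCM.IsSolution (CCM.closedLoop f B (CCM.gain B M γ γ₀) xd ud l) p →
        (p 0).1 ∈ Metric.ball (xd 0) ε → (p 0).2 ∈ Metric.ball (xd 0) ε →
          -- the system is contracting under `α(x,t) = u_d(t) + β(x,z(t)) - β(x_d(t),z(t))`
          CCM.IsContractingFrom
            (CCM.plant f B
              (fun x t => CCM.feedback (CCM.gain B M γ γ₀) xd ud t x (p t).2))
            (Metric.ball (xd 0) ε) ∧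
          -- tracking
          Tendsto (fun t => ‖(p t).1 - xd t‖) atTop (𝓝 0) := by
  have hlam := hM.lam_pos
  have hplow := hM.plow_pos
  have hpup : 0 < pup := by
    have h1 := (hM.lower 0 (CCM.stdBasis ⟨0, by omega⟩)).trans (hM.upper 0 _)
    rw [CCM.norm_stdBasis] at h1
    linarith
  obtain ⟨U₀, hU₀⟩ := hudbdd
  obtain ⟨R, hR⟩ := hxdbdd
  have hU : ∀ t : ℝ, 0 ≤ t → ‖ud t‖ ≤ max U₀ 0 := fun t ht => (hU₀ t ht).trans (le_max_left _ _)
  have hrl : 0 < 1 - 1 / (2 * r * lam) := by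
    rw [div_lt_iff₀ (by positivity)] at hr
    rw [sub_pos, div_lt_one] <;> linarith
  have hf2 : ContDiff ℝ 2 f := contDiff_infty.1 hf 2
  have hB2 : ContDiff ℝ 2 B := contDiff_infty.1 hB 2
  have hK : ContDiff ℝ 1 (CCM.gain B M γ γ₀) :=
    CCM.contDiff_gain (hB.of_le (by exact_mod_cast le_top))
      (hM.smooth.of_le (by exact_mod_cast le_top)) (hγ.of_le (by exact_mod_cast le_top))
      (fun x => (hM.injective x).comp (hBrank x)) γ₀
  have hlin := fun x v u => hM.inner_linearization_le hmn (hB2.differentiable two_ne_zero) hBrank hr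
    hγbound γ₀ x v u
  have hμ : 0 < min (lam * plow * (1 - 1 / (2 * r * lam))) (2 * γ₀) := by positivity
  set μ := min (lam * plow * (1 - 1 / (2 * r * lam))) (2 * γ₀)
  -- The largest error that both Lyapunov estimates tolerate; it fixes the tube radius `ρ`, and `ρ`
  -- fixes the admissible `ε`.
  have hη : 0 < min (μ / 6) l := by positivity
  have hημ : 6 * min (μ / 6) l ≤ μ := by linarith [min_le_left (μ / 6) l]
  obtain ⟨ρ, L, hρ, hL, htube⟩ := CCM.exists_isTubeBound hf2 hB2 hK hM.smooth.continuous hlin R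
    (le_max_right U₀ 0) hη
  obtain ⟨ε₁, hε₁, hε₁'⟩ := CCM.exists_pos_forall_lt_mul_sq_lt
    (a := plow * ρ ^ 2) (c := pup) (by positivity) hpup
  obtain ⟨ε₂, hε₂, hε₂'⟩ := CCM.exists_pos_forall_lt_mul_sq_lt
    (a := min plow 1 / 2 * ρ ^ 2) (c := pup + 4) (by positivity) (by positivity)
  refine ⟨min ε₁ ε₂, lt_min hε₁ hε₂, fun ε hε hεlt => ?_⟩
  have hS₂ : ∀ p ∈ Metric.ball (xd 0) ε ×ˢ Metric.ball (xd 0) ε,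
      (pup + 4) * ‖p - (xd 0, xd 0)‖ ^ 2 < min plow 1 / 2 * ρ ^ 2 := by
    intro p hp
    rw [ball_prod_same, mem_ball_iff_norm] at hp
    exact hε₂' _ (norm_nonneg _) (hp.trans (hεlt.trans_le (min_le_right _ _)))
  have hloop := CCM.isContractingFrom_closedLoop hM htube hμ hη.le hημ (min_le_right _ _) hl hpup hρ
    hL hf.continuous hB.continuous hK.continuous hud.continuousOn hxd hR hU hS₂
  refine ⟨hloop, fun p hp hp₁ hp₂ => ⟨?_, ?_⟩⟩
  -- The closed-loop tube confines `z`, which may then be treated as an exogenous signal.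
  · have hmem : ∀ t, 0 ≤ t → ‖(p t).2 - xd t‖ ≤ ρ := by
      intro t ht
      have := (CCM.isIncrementalLyapunov_closedLoop hM htube hμ hη.le hημ (min_le_right _ _) hpup
        hxd hR hU).mem_ball_of_isSolution (by positivity) hρ (by positivity)
        (CCM.isSolution_closedLoop_target hxd) hp (hS₂ _ ⟨hp₁, hp₂⟩) ht
      exact (norm_snd_le _).trans (mem_ball_iff_norm.1 this).le
    refine CCM.isContractingFrom_plant hM htube hμ hημ hpup hρ hL hf.continuous hB.continuous
      hK.continuous hud.continuousOn hxd hR hU hp.continuousOn.snd hmem fun x hx => ?_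
    exact hε₁' _ (norm_nonneg _)
      ((mem_ball_iff_norm.1 hx).trans (hεlt.trans_le (min_le_left _ _)))
  · have hmem := Metric.mem_ball_self (x := xd 0) hε
    have := hloop.tendsto_norm_sub hp (CCM.isSolution_closedLoop_target hxd) ⟨hp₁, hp₂⟩
      ⟨hmem, hmem⟩
    exact squeeze_zero (fun t => norm_nonneg _)
      (fun t => norm_fst_le (p t - (xd t, xd t))) this
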